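/- Let $k$ be a field, $G$ a connected smooth $k$-group scheme of finite type, and $X$ a quasi-compact quasi-separated $k$-scheme with a left action of $G$ over $k$. Write $k[Y]=\Gamma(Y,\mathcal O_Y)$. Assume that $k[X]$ is reduced and that $k$ is integrally closed in $k[X]$ (that is, $k\to k[X]$ is injective, so $X\neq\emptyset$, and its image contains every element of $k[X]$ integral over $k$). Put $$\mathcal X(G)=\{\chi\in k[G]^\times\mid \chi(g_1g_0)=\chi(g_1)\chi(g_0)\},\qquad k[X]^G=\{f\in k[X]\mid f(gx)=f(x)\},$$ $$\mathcal X(G,X)=\{\chi\in\mathcal X(G)\mid \exists\,\alpha\in k[X]^\times:\ \alpha(gx)=\chi(g)\alpha(x)\},$$ all identities being between functions on $G\times G$, respectively $G\times X$. For $n\ge 0$ let $d_i:G^{n+1}\times X\to G^n\times X$ ($0\le i\le n+1$) be $$d_i(g_n,\dots,g_0,x)=\begin{cases}(g_n,\dots,g_1,g_0x)& i=0\\ (g_n,\dots,g_ig_{i-1},\dots,g_0,x)&0<i\le n\\ (g_{n-1},\dots,g_0,x)& i=n+1,\end{cases}$$ let $\partial^n:k[G^n\times X]^\times\to k[G^{n+1}\times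 X]^\times$, $\partial^n\chi=\prod_{i=0}^{n+1}(\chi\circ d_i)^{(-1)^i}$, and let $Z^n=\ker\partial^n$, $B^0=\{1\}$, $B^{n}=\operatorname{im}\partial^{n-1}$ for $n\ge1$, and $H^n_{\mathrm{alg}}(G,\mathcal O_X^\times)=Z^n/B^n$ be the cocycles, coboundaries and cohomology of this complex. Then for every $n\ge 0$, every $\chi\in k[G^n\times X]^\times$ can be written uniquely as $$\chi(g_{n-1},\dots,g_0,x)=\chi_{n-1}(g_{n-1})\cdots\chi_0(g_0)\,\alpha(x),\qquad \chi_0,\dots,\chi_{n-1}\in\mathcal X(G),\ \alpha\in k[X]^\times .$$ Moreover, in terms of this factorization: 1. $Z^0=(k[X]^G)^\times$ and $B^0=\{1\}$. 2. If $n\ge2$ is even, then $$Z^n=B^n=\{\chi\mid \alpha(gx)=\chi_0(g)\alpha(x),\ \chi_1=\chi_2,\ \chi_3=\chi_4,\ \dots,\ \chi_{n-3}=\chi_{n-2},\ \chi_{n-1}=1\}.$$ 3. If $n$ is odd, then $Z^n=\{\chi\mid \alpha=1,\ \chi_1=\chi_3=\cdots=\chi_{n-2}=1\}$. 4. If $n\ge3$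 is odd, then $B^n=Z^n$; and $B^1=\{\chi\in k[G\times X]^\times\mid\alpha=1,\ \chi_0\in\mathcal X(G,X)\}$. Consequently $H^0_{\mathrm{alg}}(G,\mathcal O_X^\times)=(k[X]^G)^\times$, $H^1_{\mathrm{alg}}(G,\mathcal O_X^\times)\cong\mathcal X(G)/\mathcal X(G,X)$ (the class of $\chi\in\mathcal X(G)$ corresponding to the class of the cocycle $(g,x)\mapsto\chi(g)$), and $H^n_{\mathrm{alg}}(G,\mathcal O_X^\times)=0$ for $n\ge2$. -/

import Mathlib

open CategoryTheory Limits MonoidalCategory CartesianMonoidalCategory MonObj AlgebraicGeometry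

universe u

noncomputable section

namespace AlgCoh

section Units

variable {k : Type u} [Field k]

/-- The ring `k[X] = Γ(X, 𝒪_X)` of global functions of a `k`-scheme `X`. -/
abbrev functions (X : Over (Spec (.of k))) : Type u := Γ(X.left, ⊤)

/-- The structure homomorphism `k → k[X]` as an algebra structure. -/
instance functionsAlgebra (X : Over (Spec (.of k))) : Algebra k (functions X) :=
  ((Scheme.ΓSpecIso (.of k)).inv ≫ X.hom.appTop).hom.toAlgebra

/-- Pullback of functions `f ↦ f ∘ φ` along a morphism `φ : X ⟶ Y` of `k`-schemes. -/
def pullFun {X Y : Over (Spec (.of k))} (φ : X ⟶ Y) : functions Y →+* functions X :=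
  φ.left.appTop.hom

/-- Pullback of invertible functions along a morphism of `k`-schemes. -/
def pull {X Y : Over (Spec (.of k))} (φ : X ⟶ Y) : (functions Y)ˣ →* (functions X)ˣ :=
  Units.map (pullFun φ : functions Y →* functions X)

lemma pull_comp {X Y Z : Over (Spec (.of k))} (φ : X ⟶ Y) (ψ : Y ⟶ Z) (f : (functions Z)ˣ) :
    pull (φ ≫ ψ) f = pull φ (pull ψ f) := by
  ext
  exact congrArg (fun q => q.hom (f : functions Z)) (Scheme.Hom.comp_appTop φ.left ψ.left)

end Units

section Characters

variable {k : Type u} [Field k] (G : Over (Spec (.of k))) [GrpObj G]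

/-- The character group `𝒳(G)`: invertible functions `χ` on `G` with
`χ(g₁ g₀) = χ(g₁) χ(g₀)` as functions on `G × G`. -/
def characters : Subgroup (functions G)ˣ where
  carrier := {χ | pull μ[G] χ = pull (fst G G) χ * pull (snd G G) χ}
  one_mem' := by simp
  mul_mem' {a b} ha hb := by
    simp only [Set.mem_ofPred_eq, map_mul] at *
    rw [ha, hb, _root_.mul_mul_mul_comm]
  inv_mem' {a} ha := by
    simp only [Set.mem_ofPred_eq, map_inv] at *
    rw [ha, mul_inv]

variable (X : Over (Spec (.of k))) [ModObj G X]

/-- The action morphism `G × X ⟶ X`, `(g, x) ↦ g x`. -/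
def act : G ⊗ X ⟶ X := ModObj.smul (M := G) (X := X)

/-- `α(g x) = χ(g) α(x)` as functions on `G × X`. -/
def IsSemiInvariant (χ : (functions G)ˣ) (α : (functions X)ˣ) : Prop :=
  pull (act G X) α = pull (fst G X) χ * pull (snd G X) α

/-- `𝒳(G, X)`: the characters `χ` of `G` for which some `α ∈ k[X]ˣ` satisfies
`α(g x) = χ(g) α(x)`. -/
def semiCharacters : Subgroup (characters G) where
  carrier := {χ | ∃ α : (functions X)ˣ, IsSemiInvariant G X χ α}
  one_mem' := ⟨1, by simp [IsSemiInvariant]⟩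
  mul_mem' := by
    rintro a b ⟨α, hα⟩ ⟨β, hβ⟩
    refine ⟨α * β, ?_⟩
    simp only [IsSemiInvariant, map_mul, Subgroup.coe_mul] at *
    rw [hα, hβ, _root_.mul_mul_mul_comm]
  inv_mem' := by
    rintro a ⟨α, hα⟩
    refine ⟨α⁻¹, ?_⟩
    simp only [IsSemiInvariant, map_inv, Subgroup.coe_inv] at *
    rw [hα, mul_inv]

/-- The ring of invariants `k[X]^G`: functions `f` with `f(g x) = f(x)` on `G × X`. -/
def invariants : Subring (functions X) :=
  (pullFun (act G X)).eqLocus (pullFun (snd G X))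

end Characters

section Complex

variable {k : Type u} [Field k] (G : Over (Spec (.of k))) (X : Over (Spec (.of k)))

/-- The `k`-scheme `Gⁿ × X`, a point of which is written `(g_{n-1}, …, g₀, x)`. -/
def bar (n : ℕ) : Over (Spec (.of k)) := (∏ᶜ fun _ : Fin n => G) ⊗ X

/-- The coordinate `(g_{n-1}, …, g₀, x) ↦ g_j`. -/
def coord {n : ℕ} (j : Fin n) : bar G X n ⟶ G :=
  fst (∏ᶜ fun _ : Fin n => G) X ≫ Pi.π (fun _ : Fin n => G) j

/-- The coordinate `(g_{n-1}, …, g₀, x) ↦ x`. -/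
def base (n : ℕ) : bar G X n ⟶ X := snd (∏ᶜ fun _ : Fin n => G) X

variable {G X} in
/-- The morphism to `Gⁿ × X` with given coordinates. -/
def toBar {T : Over (Spec (.of k))} {n : ℕ} (g : Fin n → (T ⟶ G)) (x : T ⟶ X) :
    T ⟶ bar G X n :=
  lift (Pi.lift g) x

variable {G X} in
@[simp] lemma toBar_coord {T : Over (Spec (.of k))} {n : ℕ} (g : Fin n → (T ⟶ G)) (x : T ⟶ X)
    (j : Fin n) : toBar g x ≫ coord G X j = g j :=
  (lift_fst_assoc _ _ _).trans (limit.lift_π _ _)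

variable {G X} in
@[simp] lemma toBar_base {T : Over (Spec (.of k))} {n : ℕ} (g : Fin n → (T ⟶ G)) (x : T ⟶ X) :
    toBar g x ≫ base G X n = x :=
  lift_snd _ _

variable {G X} in
lemma bar_hom_ext {T : Over (Spec (.of k))} {n : ℕ} {f h : T ⟶ bar G X n}
    (hc : ∀ j, f ≫ coord G X j = h ≫ coord G X j) (hb : f ≫ base G X n = h ≫ base G X n) :
    f = h := by
  refine CartesianMonoidalCategory.hom_ext _ _ ?_ hb
  refine Pi.hom_ext _ _ fun j => ?_
  exact (Category.assoc _ _ _).trans ((hc j).trans (Category.assoc _ _ _).symm)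

variable [GrpObj G] [ModObj G X]

/-- The face morphisms `dᵢ : G^{n+1} × X ⟶ Gⁿ × X`, `0 ≤ i ≤ n + 1`:
* `d₀ (g_n, …, g₀, x) = (g_n, …, g₁, g₀ x)`;
* `dᵢ (g_n, …, g₀, x) = (g_n, …, g_i g_{i-1}, …, g₀, x)` for `0 < i ≤ n`;
* `d_{n+1} (g_n, …, g₀, x) = (g_{n-1}, …, g₀, x)`. -/
def face (n : ℕ) (i : Fin (n + 2)) : bar G X (n + 1) ⟶ bar G X n :=
  toBar
    (fun j : Fin n =>
      if (j : ℕ) + 1 < i then coord G X j.castSucc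
      else if (j : ℕ) + 1 = i then lift (coord G X j.succ) (coord G X j.castSucc) ≫ μ[G]
      else coord G X j.succ)
    (if i = 0 then lift (coord G X 0) (base G X (n + 1)) ≫ act G X else base G X (n + 1))

/-- The coboundary `∂ⁿ : k[Gⁿ × X]ˣ → k[G^{n+1} × X]ˣ`, the alternating sum of the pullbacks
along the faces, written multiplicatively: `χ ↦ ∏ᵢ (χ ∘ dᵢ)^{(-1)^i}`. -/
def coboundary (n : ℕ) : (functions (bar G X n))ˣ →* (functions (bar G X (n + 1)))ˣ where
  toFun χ := ∏ i : Fin (n + 2), pull (face G X n i) χ ^ ((-1 : ℤ) ^ (i : ℕ))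
  map_one' := by simp
  map_mul' a b := by simp [mul_zpow, Finset.prod_mul_distrib]

/-- The cocycles `Zⁿ_alg(G, 𝒪_X^×)`. -/
def cocycles (n : ℕ) : Subgroup (functions (bar G X n))ˣ := (coboundary G X n).ker

/-- The coboundaries `Bⁿ_alg(G, 𝒪_X^×)`. -/
def coboundaries : (n : ℕ) → Subgroup (functions (bar G X n))ˣ
  | 0 => ⊥
  | n + 1 => (coboundary G X n).range

lemma lift_act_assoc {T : Over (Spec (.of k))} (a b : T ⟶ G) (x : T ⟶ X) :
    lift (lift a b ≫ μ[G]) x ≫ act G X = lift a (lift b x ≫ act G X) ≫ act G X := by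
  have h : μ[G] ▷ X ≫ act G X = (α_ G G X).hom ≫ G ◁ act G X ≫ act G X :=
    ModObj.mul_smul (M := G) X
  have e1 : lift (lift a b ≫ μ[G]) x = lift (lift a b) x ≫ μ[G] ▷ X := by simp
  have e2 : lift a (lift b x ≫ act G X) =
      lift (lift a b) x ≫ (α_ G G X).hom ≫ G ◁ act G X := by simp
  rw [e1, e2, Category.assoc, h]
  simp only [Category.assoc]

lemma lift_mul_assoc {T : Over (Spec (.of k))} (a b c : T ⟶ G) :
    lift (lift a b ≫ μ[G]) c ≫ μ[G] = lift a (lift b c ≫ μ[G]) ≫ μ[G] := by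
  have e1 : lift (lift a b ≫ μ[G]) c = lift (lift a b) c ≫ μ[G] ▷ G := by simp
  have e2 : lift a (lift b c ≫ μ[G]) =
      lift (lift a b) c ≫ (α_ G G G).hom ≫ G ◁ μ[G] := by simp
  rw [e1, e2, Category.assoc, MonObj.mul_assoc]
  simp only [Category.assoc]

lemma face_coord (n : ℕ) (i : Fin (n + 2)) (j : Fin n) :
    face G X n i ≫ coord G X j =
      if (j : ℕ) + 1 < i then coord G X j.castSucc
      else if (j : ℕ) + 1 = i then lift (coord G X j.succ) (coord G X j.castSucc) ≫ μ[G]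
      else coord G X j.succ :=
  toBar_coord _ _ _

lemma face_base (n : ℕ) (i : Fin (n + 2)) :
    face G X n i ≫ base G X n =
      if i = 0 then lift (coord G X 0) (base G X (n + 1)) ≫ act G X else base G X (n + 1) :=
  toBar_base _ _

lemma face_comp_face (n : ℕ) (i j : Fin (n + 2)) (hij : i ≤ j) :
    face G X (n + 1) j.succ ≫ face G X n i = face G X (n + 1) i.castSucc ≫ face G X n j := by
  rw [Fin.le_def] at hij
  refine bar_hom_ext (fun l => ?_) ?_
  · simp only [Category.assoc, face_coord]
    split_ifs <;> simp only [face_coord, comp_lift_assoc, Fin.val_succ,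
      Fin.val_castSucc] <;> split_ifs <;>
      first | rfl | omega | exact lift_mul_assoc _ _ _ _
  · simp only [Category.assoc, face_base]
    by_cases hj : j = 0
    · have hi : i = 0 := Fin.ext (by simpa [hj] using hij)
      subst hi hj
      simp [face_base, face_coord, comp_lift_assoc, lift_act_assoc]
    · have hj' : 0 < j := Fin.pos_of_ne_zero hj
      by_cases hi : i = 0 <;>
        simp [hi, hj, hj', face_base, face_coord, comp_lift_assoc]

lemma alternating_prod_eq_one {A : Type u} [CommGroup A] (n : ℕ)
    (f : Fin (n + 3) → Fin (n + 2) → A)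
    (hf : ∀ i j : Fin (n + 2), i ≤ j → f j.succ i = f i.castSucc j) :
    ∏ i : Fin (n + 3), (∏ j : Fin (n + 2), f i j ^ ((-1 : ℤ) ^ (j : ℕ))) ^ ((-1 : ℤ) ^ (i : ℕ))
      = 1 := by
  simp only [← Finset.prod_zpow, ← zpow_mul]
  rw [← Finset.prod_product', Finset.univ_product_univ]
  let S : Finset (Fin (n + 3) × Fin (n + 2)) := {ij | (ij.1 : ℕ) ≤ (ij.2 : ℕ)}
  rw [← Finset.prod_mul_prod_compl S, ← eq_inv_iff_mul_eq_one, ← Finset.prod_inv_distrib]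
  have hS : ∀ ij, ij ∈ S ↔ (ij.1 : ℕ) ≤ (ij.2 : ℕ) := by simp [S]
  refine Finset.prod_bij' (fun ij hij => (ij.2.succ, ij.1.castLT (by have := (hS _).1 hij; omega)))
    (fun ij hij => (ij.2.castSucc, ij.1.pred (by
      rintro h
      have := (hS ij).not.1 (Finset.mem_compl.1 hij)
      simp [h] at this))) ?_ ?_ ?_ ?_ ?_
  · intro ij hij
    have := (hS _).1 hij
    rw [Finset.mem_compl, hS]
    simp
    omega
  · intro ij hij
    have := (hS ij).not.1 (Finset.mem_compl.1 hij)
    rw [hS]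
    simp
    omega
  · intro ij hij
    simp
  · intro ij hij
    simp
  · rintro ⟨i, j⟩ hij
    have hij' : (i : ℕ) ≤ j := (hS _).1 hij
    have h := hf (i.castLT (by omega)) j (by simpa [Fin.le_def] using hij')
    simp only [Fin.castSucc_castLT] at h
    simp only [h, Fin.val_succ, Fin.val_castLT, pow_succ]
    rw [← zpow_neg]
    congr 1
    ring

lemma coboundary_apply (n : ℕ) (χ : (functions (bar G X n))ˣ) :
    coboundary G X n χ = ∏ i : Fin (n + 2), pull (face G X n i) χ ^ ((-1 : ℤ) ^ (i : ℕ)) :=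
  rfl

lemma coboundary_coboundary (n : ℕ) (χ : (functions (bar G X n))ˣ) :
    coboundary G X (n + 1) (coboundary G X n χ) = 1 := by
  rw [coboundary_apply G X (n + 1)]
  refine Eq.trans (Finset.prod_congr rfl fun i _ => ?_) (alternating_prod_eq_one n
    (fun i j => pull (face G X (n + 1) i ≫ face G X n j) χ) ?_)
  · simp only [coboundary_apply, map_prod, map_zpow, pull_comp]
  intro i j hij
  simp only [face_comp_face G X n i j hij]

/-- The `Bⁿ` really are contained in the `Zⁿ`. -/
lemma coboundaries_le_cocycles (n : ℕ) : coboundaries G X n ≤ cocycles G X n := by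
  cases n with
  | zero => exact bot_le
  | succ n =>
    rintro _ ⟨χ, rfl⟩
    exact coboundary_coboundary G X n χ

/-- The algebraic `G`-cohomology `Hⁿ_alg(G, 𝒪_X^×) = Zⁿ / Bⁿ`. -/
abbrev cohomology (n : ℕ) : Type u :=
  cocycles G X n ⧸ (coboundaries G X n).subgroupOf (cocycles G X n)

/-- The function `(g_{n-1}, …, g₀, x) ↦ χ_{n-1}(g_{n-1}) ⋯ χ₀(g₀) α(x)` on `Gⁿ × X`. -/
def prodUnit {n : ℕ} (c : Fin n → characters G) (α : (functions X)ˣ) :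
    (functions (bar G X n))ˣ :=
  (∏ j : Fin n, pull (coord G X j) (c j : (functions G)ˣ)) * pull (base G X n) α

end Complex

end AlgCoh

end

/-!
Everything rests on one fact about units, in the spirit of Rosenlicht: if `k` is integrally closed
in `k[Y]`, then an invertible function on `G × Y` is uniquely `χ(g) α(y)` with a character `χ` and
`α ∈ k[Y]ˣ` (`exists_character_mul`, `character_mul_injective`). By the Künneth formula
(`kunneth_bijective`) `k[G × Y] = k[Y] ⊗ k[G]`, and one may divide by the restriction to `{e} × Y`,
so let `x` be a unit of `k[Y] ⊗ k[G]` with value `1` at `e`. Expand `x` in a `k`-basis of `k[G]`.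
If some coefficient were not integral over `k`, it would have a pole at some valuation ring `V ⊇ k`
of a field to which `k[Y]` maps. Rescale `x` and `x⁻¹` to elements over `V` with nonzero
reductions. Their product is the product of their values at `e`, and it reduces to `0`, although
`κ ⊗ k[G]` is a domain for the residue field `κ` of `V` (`isIntegral_repr_of_isUnit`). So the
coefficients lie in `k`, and `x` comes from `G`. Applied to `Y = G` and the function
`χ(g h) / (χ(g) χ(h))`, this makes every unit of `k[G]` with value `1` at `e` a character.

The algebra `k[G]` stays a domain after every extension of the ground field because `G` becomes
integral over an algebraic closure of `k` (`isGeometricDomain_functions`): it stays connected as it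
has a rational point, it is irreducible because translations act transitively on closed points, and
it is reduced because it is smooth. For the same reason `k` remains integrally closed in `k[G × Y]`
(`isIntegrallyClosedIn_tensorProduct`), so the factorization of units iterates to `Gⁿ × X`
(`prodUnitHom_bijective`).

Applied to the function `α(g x)`, the factorization shows that every `α ∈ k[X]ˣ` is semi-invariant
for a unique character `χ` (`exists_isSemiInvariant`).
Number the sequence `χ, χ₀, …, χ_{n-1}, 1` from `0` (`extend`). The pullback along the face `dᵢ` has
at the coordinate `g_l` the `l`-th entry if `i ≤ l` and the next one if `l < i`
(`pull_face_prodUnit`). The signs in `∂ⁿ` leave quotients of neighbouring entries for even `n` and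
single entries for odd `n` (`coboundary_prodUnit`), and the cocycles and coboundaries can be read
off.
-/

open scoped TensorProduct

/-! ### Units of tensor products -/

namespace AlgCoh

section Valuation

variable {k A : Type u} [Field k] [CommRing A] [Algebra k A]

/-- An element of a `k`-algebra that is not integral over `k` stays non-integral modulo some prime
ideal: a prime disjoint from the multiplicative set of all `p(f)` with `p` monic will do. -/
lemma exists_prime_of_not_isIntegral {f : A} (hf : ¬ _root_.IsIntegral k f) :
    ∃ P : Ideal A, P.IsPrime ∧ ¬ _root_.IsIntegral k (Ideal.Quotient.mk P f) := by
  let S : Submonoid A :=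
    { carrier := {a | ∃ p : Polynomial k, p.Monic ∧ Polynomial.aeval f p = a}
      one_mem' := ⟨1, Polynomial.monic_one, map_one _⟩
      mul_mem' := by
        rintro _ _ ⟨p, hp, rfl⟩ ⟨q, hq, rfl⟩
        exact ⟨p * q, hp.mul hq, map_mul _ _ _⟩ }
  have h0 : Disjoint ((⊥ : Ideal A) : Set A) (S : Set A) := by
    rw [Set.disjoint_left]
    rintro x hx ⟨p, hp, rfl⟩
    exact hf ⟨p, hp, hx⟩
  obtain ⟨P, hP, -, hd⟩ := Ideal.exists_le_prime_disjoint _ S h0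
  refine ⟨P, hP, ?_⟩
  rintro ⟨p, hp, hx⟩
  rw [← Polynomial.aeval_def, ← Ideal.Quotient.mkₐ_eq_mk k, Polynomial.aeval_algHom_apply] at hx
  exact Set.disjoint_left.1 hd (Ideal.Quotient.eq_zero_iff_mem.1 hx) ⟨p, hp, rfl⟩

/-- An element `f` of a `k`-algebra that is not integral over `k` has a pole at some valuation ring
containing `k` of a field to which the algebra maps. -/
lemma exists_valuationSubring_of_not_isIntegral {f : A} (hf : ¬ _root_.IsIntegral k f) :
    ∃ (L : Type u) (_ : Field L) (_ : Algebra k L) (φ : A →ₐ[k] L) (V : ValuationSubring L),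
      (∀ c : k, algebraMap k L c ∈ V) ∧ φ f ∉ V := by
  obtain ⟨P, hP, hfP⟩ := exists_prime_of_not_isIntegral hf
  let L := FractionRing (A ⧸ P)
  let φ : A →ₐ[k] L := (IsScalarTower.toAlgHom k (A ⧸ P) L).comp (Ideal.Quotient.mkₐ k P)
  have hφ : ¬ _root_.IsIntegral k (φ f) := fun h =>
    hfP ((isIntegral_algHom_iff (IsScalarTower.toAlgHom k (A ⧸ P) L)
      (IsFractionRing.injective (A ⧸ P) L)).1 h)
  let R : Subring L := (integralClosure k L).toSubring
  have hR : IsIntegrallyClosedIn R L :=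
    inferInstanceAs (IsIntegrallyClosedIn (integralClosure k L) L)
  obtain ⟨V, hRV, hV⟩ := Subring.exists_le_valuationSubring_of_isIntegrallyClosedIn
    (R := R) (x := φ f) hφ
  exact ⟨L, inferInstance, inferInstance, φ, V,
    fun c => hRV (show algebraMap k L c ∈ integralClosure k L from Subalgebra.algebraMap_mem _ c),
    hV⟩

end Valuation

section Tensor

variable {k A B : Type u} [Field k] [CommRing A] [CommRing B] [Algebra k A] [Algebra k B]

/-- A `k`-algebra is geometrically a domain if it stays a domain after every extension of the
ground field. -/
def IsGeometricDomain (k B : Type u) [Field k] [CommRing B] [Algebra k B] : Prop :=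
  ∀ (K : Type u) [Field K] [Algebra k K], IsDomain (K ⊗[k] B)

/-- Evaluation of the second factor of `A ⊗ B` at a `k`-point of `B`. -/
noncomputable def evalRight (A : Type u) [CommRing A] [Algebra k A] (e : B →ₐ[k] k) :
    A ⊗[k] B →ₐ[k] A :=
  Algebra.TensorProduct.lift (AlgHom.id k A) ((Algebra.ofId k A).comp e) fun _ _ => .all _ _

@[simp] lemma evalRight_tmul (e : B →ₐ[k] k) (a : A) (b : B) :
    evalRight A e (a ⊗ₜ b) = a * algebraMap k A (e b) := by
  simp [evalRight, Algebra.ofId_apply]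

lemma evalRight_map {A' : Type u} [CommRing A'] [Algebra k A'] (φ : A →ₐ[k] A') (e : B →ₐ[k] k)
    (x : A ⊗[k] B) :
    evalRight A' e (Algebra.TensorProduct.map φ (AlgHom.id k B) x) = φ (evalRight A e x) := by
  have : (evalRight A' e).comp (Algebra.TensorProduct.map φ (AlgHom.id k B)) =
      φ.comp (evalRight A e) := by
    ext <;> simp
  exact DFunLike.congr_fun this x

variable {J : Type u} (b : Module.Basis J k B)

lemma basis_repr_map {A' : Type u} [CommRing A'] [Algebra k A'] (φ : A →ₐ[k] A')
    (x : A ⊗[k] B) (i : J) :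
    (Algebra.TensorProduct.basis A' b).repr (Algebra.TensorProduct.map φ (AlgHom.id k B) x) i =
      φ ((Algebra.TensorProduct.basis A b).repr x i) := by
  induction x using TensorProduct.induction_on with
  | zero => simp
  | tmul a c => simp
  | add x y hx hy => simp [hx, hy]

/-- Over a valuation ring `V` of `L ⊇ k`, a nonzero element of `L ⊗ B` is a scalar multiple of an
element of `V ⊗ B` that does not vanish in the residue field. The scalar `c` is the coefficient of
largest valuation. -/
lemma exists_primitive {L : Type u} [Field L] [Algebra k L] (V : ValuationSubring L) [Algebra k V]
    [IsScalarTower k V L] (x : L ⊗[k] B) (hx : x ≠ 0) :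
    ∃ (c : L) (w : V ⊗[k] B), c ≠ 0 ∧
      (∀ i, V.valuation ((Algebra.TensorProduct.basis L b).repr x i) ≤ V.valuation c) ∧
      x = c • Algebra.TensorProduct.map (IsScalarTower.toAlgHom k V L) (AlgHom.id k B) w ∧
      Algebra.TensorProduct.map (IsScalarTower.toAlgHom k V (IsLocalRing.ResidueField V))
        (AlgHom.id k B) w ≠ 0 := by
  set r := (Algebra.TensorProduct.basis L b).repr x with hr
  have hr0 : r.support.Nonempty := by
    rw [Finsupp.support_nonempty_iff]
    simpa [hr] using hx
  obtain ⟨i₀, hi₀, hmax⟩ := r.support.exists_max_image (fun i => V.valuation (r i)) hr0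
  have hc : r i₀ ≠ 0 := Finsupp.mem_support_iff.1 hi₀
  have hle : ∀ i, V.valuation (r i) ≤ V.valuation (r i₀) := fun i => by
    by_cases hi : i ∈ r.support
    · exact hmax i hi
    · simp [Finsupp.notMem_support_iff.1 hi]
  have hmem : ∀ i, (r i₀)⁻¹ * r i ∈ V := fun i => by
    rw [← V.valuation_le_one_iff, map_mul, map_inv₀]
    have h0 : V.valuation (r i₀) ≠ 0 := by simpa using hc
    calc _ ≤ (V.valuation (r i₀))⁻¹ * V.valuation (r i₀) := mul_le_mul_right (hle i) _
      _ = 1 := inv_mul_cancel₀ h0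
  let t : J →₀ V := Finsupp.onFinset r.support (fun i => ⟨(r i₀)⁻¹ * r i, hmem i⟩) fun i hi => by
    rw [Finsupp.mem_support_iff]
    rintro h
    exact hi (Subtype.ext (by simp [h]))
  let w : V ⊗[k] B := (Algebra.TensorProduct.basis V b).repr.symm t
  have hw : ∀ i, (Algebra.TensorProduct.basis V b).repr w i = t i := by simp [w]
  refine ⟨r i₀, w, hc, hle, ?_, ?_⟩
  · apply (Algebra.TensorProduct.basis L b).repr.injective
    ext i
    rw [map_smul, Finsupp.smul_apply, basis_repr_map, hw]
    change r i = r i₀ • ((r i₀)⁻¹ * r i)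
    rw [smul_eq_mul, mul_inv_cancel_left₀ hc]
  · intro h
    have := congrArg (fun y => (Algebra.TensorProduct.basis _ b).repr y i₀) h
    simp only [basis_repr_map, hw, map_zero, Finsupp.zero_apply] at this
    have h1 : t i₀ = 1 := Subtype.ext (inv_mul_cancel₀ hc)
    simp [h1] at this

/-- The coefficients of a unit of `A ⊗ B` that is `1` at a `k`-point of `B` are integral over `k`:
at a valuation where some coefficient has a pole, the unit and its inverse rescale to primitive
elements whose product reduces to `0`, against `B` being geometrically a domain. -/
lemma isIntegral_repr_of_isUnit (hB : IsGeometricDomain k B) (e : B →ₐ[k] k) {x y : A ⊗[k] B}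
    (hxy : x * y = 1) (hx : evalRight A e x = 1) (i : J) :
    _root_.IsIntegral k ((Algebra.TensorProduct.basis A b).repr x i) := by
  by_contra hi
  obtain ⟨L, _, _, φ, V, hkV, hfV⟩ := exists_valuationSubring_of_not_isIntegral hi
  let : Algebra k V := ((algebraMap k L).codRestrict V.toSubring hkV).toAlgebra
  have : IsScalarTower k V L := .of_algebraMap_eq fun _ => rfl
  let κ := IsLocalRing.ResidueField V
  have := hB L
  have := hB κ
  have hy : evalRight A e y = 1 := by simpa [hx] using congrArg (evalRight A e) hxy
  let ψ := Algebra.TensorProduct.map φ (AlgHom.id k B)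
  have hψ : ψ x * ψ y = 1 := by rw [← map_mul, hxy, map_one]
  obtain ⟨c, w, hc, hle, hw, hw0⟩ := exists_primitive b V (ψ x) (left_ne_zero_of_mul_eq_one hψ)
  obtain ⟨c', w', hc', -, hw', hw0'⟩ := exists_primitive b V (ψ y) (right_ne_zero_of_mul_eq_one hψ)
  let jL := Algebra.TensorProduct.map (IsScalarTower.toAlgHom k V L) (AlgHom.id k B)
  let jκ := Algebra.TensorProduct.map (IsScalarTower.toAlgHom k V κ) (AlgHom.id k B)
  have hjL : Function.Injective jL :=
    Module.Flat.rTensor_preserves_injective_linearMap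
      (IsScalarTower.toAlgHom k V L).toLinearMap Subtype.val_injective
  have hsmul : ∀ (d : L) (z : L ⊗[k] B), evalRight L e (d • z) = d * evalRight L e z := by
    intro d z
    rw [← one_mul z, ← smul_mul_assoc, Algebra.TensorProduct.one_def, TensorProduct.smul_tmul',
      map_mul, evalRight_tmul]
    simp
  have hev : (evalRight V e w : L) = c⁻¹ := by
    have h1 : evalRight L e (ψ x) = 1 := by rw [evalRight_map, hx, map_one]
    rw [hw, hsmul, evalRight_map] at h1
    exact eq_inv_of_mul_eq_one_right h1
  have hev' : (evalRight V e w' : L) = c'⁻¹ := by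
    have h1 : evalRight L e (ψ y) = 1 := by rw [evalRight_map, hy, map_one]
    rw [hw', hsmul, evalRight_map] at h1
    exact eq_inv_of_mul_eq_one_right h1
  have hprod : w * w' = (evalRight V e w * evalRight V e w') ⊗ₜ 1 := by
    apply hjL
    rw [hw, hw', smul_mul_smul_comm] at hψ
    rw [map_mul]
    have h2 : jL w * jL w' = (c * c')⁻¹ • 1 := by
      rw [eq_inv_smul_iff₀ (mul_ne_zero hc hc')]; exact hψ
    rw [h2, Algebra.TensorProduct.one_def, TensorProduct.smul_tmul']
    simp only [jL, Algebra.TensorProduct.map_tmul, map_mul, map_one, smul_eq_mul]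
    congr 1
    change _ = (evalRight V e w : L) * (evalRight V e w' : L)
    rw [hev, hev', mul_inv, _root_.mul_one]
  -- `c⁻¹` is in the maximal ideal, since `c` has at least the pole of the coefficient `φ (x i)`
  have hmax : algebraMap V κ (evalRight V e w) = 0 := by
    rw [IsLocalRing.ResidueField.algebraMap_eq, IsLocalRing.residue_eq_zero_iff,
      ValuationSubring.valuation_lt_one_iff, hev, map_inv₀]
    have h1 : 1 < V.valuation c := by
      refine lt_of_lt_of_le ?_ (hle i)
      rw [basis_repr_map]
      rw [← V.valuation_le_one_iff] at hfV
      exact not_le.1 hfV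
    exact inv_lt_one_of_one_lt₀ h1
  have h0 : jκ w * jκ w' = 0 := by
    rw [← map_mul, hprod]
    simp only [jκ, Algebra.TensorProduct.map_tmul, map_mul]
    change (algebraMap V κ (evalRight V e w) * _) ⊗ₜ _ = _
    rw [hmax, zero_mul, TensorProduct.zero_tmul]
  exact (mul_eq_zero.1 h0).elim hw0 hw0'

/-- A unit of `A ⊗ B` that is `1` at a `k`-point of `B` comes from `B`. -/
theorem exists_eq_one_tmul_of_isUnit (hB : IsGeometricDomain k B) (e : B →ₐ[k] k)
    (hA : IsIntegrallyClosedIn k A) {x : A ⊗[k] B} (hx : IsUnit x) (hx1 : evalRight A e x = 1) :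
    ∃ c : B, x = 1 ⊗ₜ c := by
  let b := Module.Basis.ofVectorSpace k B
  obtain ⟨y, hy⟩ := hx.exists_right_inv
  have h := isIntegral_repr_of_isUnit b hB e hy hx1
  choose f hf using fun i => (IsIntegrallyClosedIn.isIntegral_iff (R := k)).1 (h i)
  refine ⟨∑ i ∈ ((Algebra.TensorProduct.basis A b).repr x).support, f i • b i, ?_⟩
  conv_lhs => rw [← (Algebra.TensorProduct.basis A b).linearCombination_repr x]
  rw [Finsupp.linearCombination_apply, Finsupp.sum, TensorProduct.tmul_sum]
  refine Finset.sum_congr rfl fun i _ => ?_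
  rw [← hf, Algebra.TensorProduct.basis_apply, algebraMap_smul, TensorProduct.smul_tmul',
    TensorProduct.smul_tmul]

lemma isReduced_of_isIntegrallyClosedIn (hA : IsIntegrallyClosedIn k A) : _root_.IsReduced A := by
  refine ⟨fun x hx => ?_⟩
  obtain ⟨n, hn⟩ := hx
  have : _root_.IsIntegral k x :=
    ⟨Polynomial.X ^ n, Polynomial.monic_X_pow n, by simp [hn]⟩
  obtain ⟨c, rfl⟩ := (IsIntegrallyClosedIn.isIntegral_iff (R := k)).1 this
  have hinj := hA.algebraMap_injective
  rw [← map_pow, ← map_zero (algebraMap k A)] at hn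
  rw [eq_zero_of_pow_eq_zero (hinj hn), map_zero]

/-- If `k` is integrally closed in `A` and `B` is geometrically a domain with a `k`-point, then `k`
is integrally closed in `A ⊗ B`. After subtracting its value at the point, an integral element takes
the value `0` there; in the domains `L ⊗ B`, for the residue fields `L` of `A`, its minimal
polynomial then has constant term `0`, so it vanishes. -/
theorem isIntegrallyClosedIn_tensorProduct (hB : IsGeometricDomain k B) (e : B →ₐ[k] k)
    (hA : IsIntegrallyClosedIn k A) : IsIntegrallyClosedIn k (A ⊗[k] B) := by
  have := isReduced_of_isIntegrallyClosedIn hA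
  have hinj := hA.algebraMap_injective
  rw [isIntegrallyClosedIn_iff]
  refine ⟨fun a a' h => hinj ?_, fun {x} hx => ?_⟩
  · simpa using congrArg (evalRight A e) h
  obtain ⟨c, hc⟩ := (IsIntegrallyClosedIn.isIntegral_iff (R := k)).1 (hx.map (evalRight A e))
  refine ⟨c, ?_⟩
  rw [eq_comm, ← sub_eq_zero]
  set y := x - algebraMap k (A ⊗[k] B) c with hy
  have hyi : _root_.IsIntegral k y := hx.sub isIntegral_algebraMap
  have hye : evalRight A e y = 0 := by simp [hy, hc]
  let b := Module.Basis.ofVectorSpace k B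
  apply (Algebra.TensorProduct.basis A b).repr.injective
  ext i
  -- `A` is reduced, so the coefficients of `y` may be shown to vanish modulo every prime
  rw [map_zero, Finsupp.zero_apply, ← Ideal.mem_bot (R := A),
    ← Ideal.radical_bot_of_isReduced (R := A), Ideal.radical_eq_sInf, Ideal.mem_sInf]
  rintro P ⟨-, hP⟩
  let L := FractionRing (A ⧸ P)
  let φ : A →ₐ[k] L := (IsScalarTower.toAlgHom k (A ⧸ P) L).comp (Ideal.Quotient.mkₐ k P)
  let ψ := Algebra.TensorProduct.map φ (AlgHom.id k B)
  have := hB L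
  have hL : ψ y = 0 := by
    have h1 : _root_.IsIntegral k (ψ y) := hyi.map ψ
    -- evaluation at the point sends the minimal polynomial of `ψ y` to its constant term
    rw [← minpoly.coeff_zero_eq_zero h1]
    have h2 := congrArg (evalRight L e) (minpoly.aeval k (ψ y))
    rw [← Polynomial.aeval_algHom_apply, map_zero, evalRight_map, hye, map_zero,
      ← Polynomial.coeff_zero_eq_aeval_zero'] at h2
    exact (map_eq_zero _).1 h2
  have h3 := congrArg (fun z => (Algebra.TensorProduct.basis L b).repr z i) hL
  simp only [ψ, basis_repr_map, map_zero, Finsupp.zero_apply] at h3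
  exact Ideal.Quotient.eq_zero_iff_mem.1
    ((IsFractionRing.injective (A ⧸ P) L) (h3.trans (map_zero _).symm))

/-- A nonzero element of a finitely generated reduced algebra over an algebraically closed field is
nonzero at some rational point. -/
lemma exists_algHom_ne_zero [IsAlgClosed k] [Algebra.FiniteType k A] [_root_.IsReduced A] {a : A}
    (ha : a ≠ 0) : ∃ φ : A →ₐ[k] k, φ a ≠ 0 := by
  have : IsJacobsonRing A := isJacobsonRing_of_finiteType (A := k)
  have hj : Ideal.jacobson (⊥ : Ideal A) = ⊥ := by
    rw [← Ideal.radical_eq_jacobson, Ideal.radical_bot_of_isReduced]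
  have h1 : a ∉ Ideal.jacobson (⊥ : Ideal A) := by rwa [hj, Ideal.mem_bot]
  rw [Ideal.jacobson, Ideal.mem_sInf] at h1
  push Not at h1
  obtain ⟨M, ⟨-, hM⟩, haM⟩ := h1
  let : Field (A ⧸ M) := Ideal.Quotient.field M
  have : Module.Finite k (A ⧸ M) := finite_of_finite_type_of_isJacobsonRing k (A ⧸ M)
  let ε : k ≃ₐ[k] (A ⧸ M) := AlgEquiv.ofBijective (Algebra.ofId k (A ⧸ M))
    IsAlgClosed.algebraMap_bijective_of_isIntegral
  refine ⟨(ε.symm : (A ⧸ M) →ₐ[k] k).comp (Ideal.Quotient.mkₐ k M), fun h => haM ?_⟩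
  have h2 : ε.symm (Ideal.Quotient.mk M a) = 0 := h
  rw [EmbeddingLike.map_eq_zero_iff] at h2
  exact Ideal.Quotient.eq_zero_iff_mem.1 h2

/-- Over an algebraically closed field a finitely generated domain stays a domain after tensoring
with a domain: a product `x y = 0` vanishes at every rational point of the first factor, where
`x` or `y` vanishes. -/
lemma isDomain_tensorProduct_of_finiteType [IsAlgClosed k] [Algebra.FiniteType k A] [IsDomain A]
    [IsDomain B] : IsDomain (A ⊗[k] B) := by
  have : Nontrivial (A ⊗[k] B) :=
    (Algebra.TensorProduct.includeLeft_injective (S := k) (R := k) (A := A) (B := B)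
      (algebraMap k B).injective).nontrivial
  have : NoZeroDivisors (A ⊗[k] B) := by
    refine ⟨fun {x y} hxy => ?_⟩
    by_contra! hne
    let b := Module.Basis.ofVectorSpace k B
    have key : ∀ z : A ⊗[k] B, z ≠ 0 → ∃ i, (Algebra.TensorProduct.basis A b).repr z i ≠ 0 := by
      intro z hz
      by_contra! h
      exact hz ((Algebra.TensorProduct.basis A b).repr.injective (by ext i; simp [h i]))
    obtain ⟨i, hi⟩ := key x hne.1
    obtain ⟨j, hj⟩ := key y hne.2
    obtain ⟨φ, hφ⟩ := exists_algHom_ne_zero (k := k) (mul_ne_zero hi hj)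
    rw [map_mul, ← basis_repr_map, ← basis_repr_map] at hφ
    let ψ := Algebra.TensorProduct.map φ (AlgHom.id k B)
    have : IsDomain (k ⊗[k] B) := (Algebra.TensorProduct.lid k B).toMulEquiv.isDomain
    have h0 : ψ x * ψ y = 0 := by rw [← map_mul, hxy, map_zero]
    rcases mul_eq_zero.1 h0 with h | h <;> simp [ψ, h] at hφ
  exact NoZeroDivisors.to_isDomain _

/-- Over an algebraically closed field, domains are geometrically domains. -/
lemma isDomain_tensorProduct [IsAlgClosed k] [IsDomain A] [IsDomain B] : IsDomain (A ⊗[k] B) := by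
  have : Nontrivial (A ⊗[k] B) :=
    (Algebra.TensorProduct.includeLeft_injective (S := k) (R := k) (A := A) (B := B)
      (algebraMap k B).injective).nontrivial
  have : NoZeroDivisors (A ⊗[k] B) := by
    refine ⟨fun {x y} hxy => ?_⟩
    obtain ⟨D, hD, hxD⟩ := exists_fg_and_mem_baseChange x
    obtain ⟨E, hE, hyE⟩ := exists_fg_and_mem_baseChange y
    have : Algebra.FiniteType k ↥(D ⊔ E) := (D ⊔ E).fg_iff_finiteType.1 (hD.sup hE)
    have : IsDomain (↥(D ⊔ E) ⊗[k] A) := isDomain_tensorProduct_of_finiteType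
    have : IsDomain (A ⊗[k] ↥(D ⊔ E)) :=
      (Algebra.TensorProduct.comm k A ↥(D ⊔ E)).toMulEquiv.isDomain
    have hinj : Function.Injective (Algebra.TensorProduct.map (AlgHom.id A A) (D ⊔ E).val) :=
      Module.Flat.lTensor_preserves_injective_linearMap (D ⊔ E).val.toLinearMap
        Subtype.val_injective
    have lift : ∀ (F : Subalgebra k B) (hF : F ≤ D ⊔ E) (z : A ⊗[k] B), z ∈ F.baseChange A →
        ∃ z', Algebra.TensorProduct.map (AlgHom.id A A) (D ⊔ E).val z' = z := by
      rintro F hF _ ⟨z, rfl⟩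
      refine ⟨Algebra.TensorProduct.map (AlgHom.id A A) (Subalgebra.inclusion hF) z, ?_⟩
      rw [← AlgHom.comp_apply, ← Algebra.TensorProduct.map_comp]
      rfl
    obtain ⟨x, rfl⟩ := lift D le_sup_left x hxD
    obtain ⟨y, rfl⟩ := lift E le_sup_right y hyE
    rw [← map_mul, map_eq_zero_iff _ hinj, mul_eq_zero] at hxy
    exact hxy.imp (by rintro rfl; exact map_zero _) (by rintro rfl; exact map_zero _)
  exact NoZeroDivisors.to_isDomain _

/-- Being geometrically a domain can be tested on an algebraically closed extension. -/
lemma isGeometricDomain_of_isAlgClosure (K : Type u) [Field K] [Algebra k K] [IsAlgClosure k K]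
    (h : IsDomain (K ⊗[k] B)) : IsGeometricDomain k B := by
  intro F _ _
  have : IsAlgClosed K := IsAlgClosure.isAlgClosed k
  have : Algebra.IsAlgebraic k K := IsAlgClosure.isAlgebraic
  let E := AlgebraicClosure F
  let σ : K →ₐ[k] E := IsAlgClosed.lift
  let : Algebra K E := σ.toRingHom.toAlgebra
  have : IsScalarTower k K E := .of_algebraMap_eq fun x => (σ.commutes x).symm
  have : IsDomain (E ⊗[K] (K ⊗[k] B)) := isDomain_tensorProduct
  have : IsDomain (E ⊗[k] B) :=
    (Algebra.TensorProduct.cancelBaseChange k K K E B).symm.toMulEquiv.isDomain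
  exact Function.Injective.isDomain
    (Algebra.TensorProduct.map (IsScalarTower.toAlgHom k F E) (AlgHom.id k B)).toRingHom
    (Module.Flat.rTensor_preserves_injective_linearMap (IsScalarTower.toAlgHom k F E).toLinearMap
      (algebraMap F E).injective)

end Tensor

end AlgCoh

/-! ### Global functions on products and on connected smooth groups -/

namespace AlgCoh

section Reduced

/-- An étale algebra over a domain is reduced: it is flat, hence embeds into its generic fibre,
which is unramified over a field. -/
lemma isReduced_of_etale (P S : Type u) [CommRing P] [IsDomain P] [CommRing S] [Algebra P S]
    [Algebra.Etale P S] : _root_.IsReduced S := by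
  let F := FractionRing P
  have := Algebra.FormallyUnramified.isReduced_of_field F (F ⊗[P] S)
  exact isReduced_of_injective
    (Algebra.TensorProduct.includeRight : S →ₐ[P] F ⊗[P] S)
    (Algebra.TensorProduct.includeRight_injective (IsFractionRing.injective P F))

/-- A smooth scheme over an integral one is reduced: locally it is étale over an affine space. -/
lemma isReduced_of_smooth {X S : Scheme.{u}} (f : X ⟶ S) [Smooth f]
    [AlgebraicGeometry.IsIntegral S] : AlgebraicGeometry.IsReduced X := by
  have (x : X) : ∃ V : X.Opens, x ∈ V ∧ IsAffineOpen V ∧ _root_.IsReduced Γ(X, V) := by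
    obtain ⟨U, hU, V, hV, hx, e, h⟩ := Smooth.exists_isStandardSmooth f x
    have : Nonempty U := ⟨⟨f x, e hx⟩⟩
    obtain ⟨n, g, hg, hge⟩ := h.exists_etale_mvPolynomial
    algebraize [g]
    exact ⟨V, hx, hV, isReduced_of_etale (MvPolynomial (Fin n) Γ(S, U)) _⟩
  choose V hxV hV hred using this
  let 𝒰 : X.OpenCover := X.openCoverOfIsOpenCover V (.mk (by
    rw [eq_top_iff]
    exact fun x _ => TopologicalSpace.Opens.mem_iSup.2 ⟨x, hxV x⟩))
  have (i : 𝒰.I₀) : AlgebraicGeometry.IsReduced (𝒰.X i) := by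
    have : IsAffine (V i) := hV i
    have : _root_.IsReduced Γ(X, V i) := hred i
    have : _root_.IsReduced Γ(V i, ⊤) :=
      isReduced_of_injective (V i).topIso.hom.hom (V i).topIso.commRingCatIsoToRingEquiv.injective
    exact isReduced_of_isAffine_isReduced (V i)
  exact IsReduced.of_openCover X 𝒰

end Reduced

section Irreducible

/-- A connected space whose points have irreducible open neighbourhoods is irreducible: the
closure of such a neighbourhood is open. -/
lemma irreducibleSpace_of_forall_exists_isOpen {T : Type*} [TopologicalSpace T] [ConnectedSpace T]
    (h : ∀ x : T, ∃ U : Set T, IsOpen U ∧ x ∈ U ∧ IsIrreducible U) : IrreducibleSpace T := by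
  obtain ⟨x₀⟩ := (inferInstance : Nonempty T)
  have hopen : IsOpen (irreducibleComponent x₀) := by
    rw [isOpen_iff_forall_mem_open]
    intro x hx
    obtain ⟨U, hU, hxU, hUi⟩ := h x
    refine ⟨U, ?_, hU, hxU⟩
    have h1 : irreducibleComponent x₀ ⊆ closure U :=
      (subset_closure_inter_of_isPreirreducible_of_isOpen
        isIrreducible_irreducibleComponent.isPreirreducible hU ⟨x, hx, hxU⟩).trans
        (closure_mono Set.inter_subset_right)
    rw [← eq_irreducibleComponent hUi.isPreirreducible.closure h1]
    exact subset_closure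
  have := IsClopen.eq_univ ⟨isClosed_irreducibleComponent, hopen⟩ ⟨x₀, mem_irreducibleComponent⟩
  rw [irreducibleSpace_def, Set.top_eq_univ, ← this]
  exact isIrreducible_irreducibleComponent

/-- A nonempty noetherian space has a nonempty irreducible open subset: the complement of all
irreducible components but one. -/
lemma exists_isOpen_isIrreducible (T : Type*) [TopologicalSpace T]
    [TopologicalSpace.NoetherianSpace T] [Nonempty T] :
    ∃ U : Set T, IsOpen U ∧ IsIrreducible U := by
  obtain ⟨x⟩ := (inferInstance : Nonempty T)
  have hfin := TopologicalSpace.NoetherianSpace.finite_irreducibleComponents (α := T)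
  refine ⟨(⋃₀ (irreducibleComponents T \ {irreducibleComponent x}))ᶜ, ?_, ?_⟩
  · rw [Set.sUnion_eq_biUnion, isOpen_compl_iff]
    exact hfin.sdiff.isClosed_biUnion fun W hW => isClosed_of_mem_irreducibleComponents W hW.1
  · rw [← isIrreducible_iff_closure, closure_sUnion_irreducibleComponents_sdiff_singleton hfin _
      (irreducibleComponent_mem_irreducibleComponents x)]
    exact isIrreducible_irreducibleComponent

variable {K : Type u} [Field K]

/-- Translations act transitively on the closed points of a group scheme over an algebraically
closed field. -/
lemma exists_homeomorph_apply_eq [IsAlgClosed K] (G : Over (Spec (.of K))) [GrpObj G]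
    [LocallyOfFiniteType G.hom] {x y : G.left} (hx : IsClosed {x}) (hy : IsClosed {y}) :
    ∃ α : G.left ≃ₜ G.left, α x = y := by
  let x' : 𝟙_ _ ⟶ G := Over.homMk _ ((pointEquivClosedPoint G.hom).symm ⟨x, hx⟩).2
  let y' : 𝟙_ _ ⟶ G := Over.homMk _ ((pointEquivClosedPoint G.hom).symm ⟨y, hy⟩).2
  let α := (GrpObj.mulRight (A := G) x').symm ≪≫ GrpObj.mulRight (A := G) y'
  have hα : x' ≫ α.hom = y' := by
    dsimp only [Iso.trans_hom, Iso.symm_hom, α]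
    rw [← Category.assoc, ← Iso.eq_comp_inv]
    simp [comp_lift_assoc]
  have hα' : α.hom.left x = y := by
    have h := congrArg (fun q => q.left (IsLocalRing.closedPoint K)) hα
    have hx' : x'.left (IsLocalRing.closedPoint K) = x := pointOfClosedPoint_apply G.hom x hx _
    have hy' : y'.left (IsLocalRing.closedPoint K) = y := pointOfClosedPoint_apply G.hom y hy _
    rw [← hx', ← hy', ← h]
    rfl
  exact ⟨Scheme.homeoOfIso ((Over.forget _).mapIso α), hα'⟩

/-- A connected group scheme of finite type over an algebraically closed field is irreducible: some
closed point has an irreducible open neighbourhood, so by translation all of them have one. -/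
lemma irreducibleSpace_of_grpObj [IsAlgClosed K] (G : Over (Spec (.of K))) [GrpObj G]
    [LocallyOfFiniteType G.hom] [CompactSpace G.left] [ConnectedSpace G.left] :
    IrreducibleSpace G.left := by
  have := LocallyOfFiniteType.jacobsonSpace G.hom
  have : IsNoetherian G.left := { __ := LocallyOfFiniteType.isLocallyNoetherian G.hom }
  obtain ⟨U, hU, hUi⟩ := exists_isOpen_isIrreducible G.left
  obtain ⟨y, hyU, hy⟩ := nonempty_inter_closedPoints hUi.nonempty hU.isLocallyClosed
  refine irreducibleSpace_of_forall_exists_isOpen fun x => ?_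
  obtain ⟨z, hzx, hz⟩ := nonempty_inter_closedPoints (Z := closure {x}) ⟨x, subset_closure rfl⟩
    isClosed_closure.isLocallyClosed
  obtain ⟨α, hα⟩ := exists_homeomorph_apply_eq G hz hy
  refine ⟨α ⁻¹' U, hU.preimage α.continuous, ?_, ?_⟩
  · have hzU : z ∈ α ⁻¹' U := by rwa [Set.mem_preimage, hα]
    exact (specializes_iff_mem_closure.2 hzx).mem_open (hU.preimage α.continuous) hzU
  · rw [← α.image_symm]
    exact hUi.image _ α.symm.continuous.continuousOn

end Irreducible

section Connected

variable {k : Type u} [Field k]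

/-- A connected scheme over `k` with a rational point stays connected over an algebraic extension
`K`. The projection from the base change is open and closed, so a nonempty clopen subset upstairs
has full image; it then contains the only point above the rational point. -/
lemma connectedSpace_pullback_of_isAlgebraic {X : Scheme.{u}} (f : X ⟶ Spec (.of k))
    [ConnectedSpace X] (e : Spec (.of k) ⟶ X) (he : e ≫ f = 𝟙 _) (K : Type u) [Field K]
    [Algebra k K] [Algebra.IsAlgebraic k K] :
    ConnectedSpace ↥(Limits.pullback f (Spec.map (CommRingCat.ofHom (algebraMap k K)))) := by
  set g := Spec.map (CommRingCat.ofHom (algebraMap k K))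
  have : IsIntegralHom g :=
    IsIntegralHom.SpecMap_iff.2 (algebraMap_isIntegral_iff.2 inferInstance)
  let p := Limits.pullback.fst f g
  have hpo : IsOpenMap p := p.isOpenMap
  have hpc : IsClosedMap p := p.isClosedMap
  let s : Spec (.of K) ⟶ Limits.pullback f g :=
    Limits.pullback.lift (g ≫ e) (𝟙 _) (by simp [he])
  have hsq : IsPullback s g p e := by
    refine .of_right ?_ (Limits.pullback.lift_fst _ _ _) (IsPullback.of_hasPullback f g).flip
    rw [he, Limits.pullback.lift_snd]
    exact .of_horiz_isIso ⟨by simp⟩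
  have hfib : ∀ x : ↥(Limits.pullback f g), p x = e (IsLocalRing.closedPoint k) →
      x = s (IsLocalRing.closedPoint K) := by
    intro x hx
    obtain ⟨z, hz, -⟩ := Scheme.exists_preimage_of_isPullback hsq x
      (IsLocalRing.closedPoint k) hx
    rw [← hz, Subsingleton.elim z (IsLocalRing.closedPoint K)]
  have hne : Nonempty ↥(Limits.pullback f g) := ⟨s (IsLocalRing.closedPoint K)⟩
  have hclopen : ∀ U : Set ↥(Limits.pullback f g), IsClopen U → U.Nonempty →
      s (IsLocalRing.closedPoint K) ∈ U := by
    intro U hU hUne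
    have := IsClopen.eq_univ ⟨hpc _ hU.1, hpo _ hU.2⟩ (hUne.image p)
    obtain ⟨x, hxU, hx⟩ := this.ge (Set.mem_univ (e (IsLocalRing.closedPoint k)))
    rwa [← hfib x hx]
  have : PreconnectedSpace ↥(Limits.pullback f g) := by
    rw [preconnectedSpace_iff_clopen]
    intro U hU
    by_contra! h
    exact hclopen _ hU.compl (Set.nonempty_compl.2 h.2) (hclopen _ hU h.1)
  exact ⟨hne⟩

end Connected

section Kunneth

variable {k : Type u} [Field k]

/-- Pullback of functions as a homomorphism of `k`-algebras. -/
noncomputable def pullAlgHom {X Y : Over (Spec (.of k))} (φ : X ⟶ Y) :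
    functions Y →ₐ[k] functions X where
  __ := pullFun φ
  commutes' c := by
    have h : Y.hom.appTop ≫ φ.left.appTop = X.hom.appTop := by
      rw [← Scheme.Hom.comp_appTop, Over.w]
    exact congrArg (fun q => q.hom ((Scheme.ΓSpecIso (.of k)).inv.hom c)) h

/-- The Künneth map `k[Y] ⊗ k[X] → k[X × Y]`. -/
noncomputable def kunneth (X Y : Over (Spec (.of k))) :
    functions Y ⊗[k] functions X →ₐ[k] functions (X ⊗ Y) :=
  Algebra.TensorProduct.productMap (pullAlgHom (snd X Y)) (pullAlgHom (fst X Y))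

lemma kunneth_tmul (X Y : Over (Spec (.of k))) (a : functions Y) (b : functions X) :
    kunneth X Y (a ⊗ₜ b) = pullFun (snd X Y) a * pullFun (fst X Y) b :=
  Algebra.TensorProduct.productMap_apply_tmul _ _ _ _

lemma appTop_eq (X : Over (Spec (.of k))) :
    X.hom.appTop =
      (Scheme.ΓSpecIso (.of k)).hom ≫ CommRingCat.ofHom (algebraMap k (functions X)) :=
  ((Iso.hom_inv_id_assoc _ _)).symm

/-- Global sections turn the fibre product over `k` into a pushout of rings; everything is flat over
`k`. -/
lemma isPushout_appTop (X Y : Over (Spec (.of k))) [CompactSpace X.left]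
    [QuasiSeparatedSpace X.left] [CompactSpace Y.left] [QuasiSeparatedSpace Y.left] :
    IsPushout X.hom.appTop Y.hom.appTop (fst X Y).left.appTop (snd X Y).left.appTop := by
  have H : IsPullback (fst X Y).left (snd X Y).left X.hom Y.hom := IsPullback.of_hasPullback _ _
  have hflat : X.hom.appTop.hom.Flat := by
    rw [appTop_eq, CommRingCat.hom_comp]
    refine .comp (.of_bijective (Scheme.ΓSpecIso (.of k)).commRingCatIsoToRingEquiv.bijective) ?_
    exact RingHom.flat_algebraMap_iff.2 inferInstance
  have h := isIso_pushoutSection_of_isCompact_of_flat_right_of_ringHomFlat H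
    (US := ⊤) (UT := ⊤) (UX := ⊤) (UY := ⊤) (by simp) (by simp) (by simp)
    (isAffineOpen_top _) isCompact_univ isQuasiSeparated_univ isCompact_univ isQuasiSeparated_univ
    (by rw [Scheme.Hom.appTop, Scheme.Hom.app_eq_appLE] at hflat; exact hflat)
  have := (isIso_pushoutSection_iff H (US := ⊤) (UT := ⊤) (UX := ⊤) (UY := ⊤) (by simp) (by simp)
    (by simp)).1 h
  simpa [Scheme.Hom.appTop, Scheme.Hom.app_eq_appLE] using this

/-- The Künneth formula for global functions on quasi-compact quasi-separated `k`-schemes. -/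
theorem kunneth_bijective (X Y : Over (Spec (.of k))) [CompactSpace X.left]
    [QuasiSeparatedSpace X.left] [CompactSpace Y.left] [QuasiSeparatedSpace Y.left] :
    Function.Bijective (kunneth X Y) := by
  have h1 : IsPushout (CommRingCat.ofHom (algebraMap k (functions Y)))
      (CommRingCat.ofHom (algebraMap k (functions X))) (snd X Y).left.appTop
      (fst X Y).left.appTop := by
    refine .of_iso (isPushout_appTop X Y).flip (Scheme.ΓSpecIso (.of k)) (.refl _) (.refl _)
      (.refl _) ?_ ?_ ?_ ?_
    · rw [appTop_eq]; simp
    · rw [appTop_eq]; simp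
    · simp
    · simp
  have h2 := CommRingCat.isPushout_tensorProduct k (functions Y) (functions X)
  let ε := h2.isoIsPushout _ _ h1
  have hl := IsPushout.inl_isoIsPushout_hom _ _ h2 h1
  have hr := IsPushout.inr_isoIsPushout_hom _ _ h2 h1
  have : ∀ x, kunneth X Y x = ε.hom.hom x := by
    intro x
    induction x using TensorProduct.induction_on with
    | zero => simp
    | add x y hx hy => rw [map_add, map_add, hx, hy]
    | tmul a b =>
      have ha : ε.hom.hom (a ⊗ₜ 1) = pullFun (snd X Y) a := congrArg (fun q => q.hom a) hl
      have hb : ε.hom.hom (1 ⊗ₜ b) = pullFun (fst X Y) b := congrArg (fun q => q.hom b) hr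
      rw [kunneth_tmul, ← ha, ← hb, ← map_mul, Algebra.TensorProduct.tmul_mul_tmul,
        _root_.mul_one, _root_.one_mul]
  rw [show ⇑(kunneth X Y) = ⇑ε.hom.hom from funext this]
  exact ε.commRingCatIsoToRingEquiv.bijective

end Kunneth

section Domain

variable {k : Type u} [Field k]

lemma quasiSeparatedSpace_of_locallyOfFiniteType (X : Over (Spec (.of k)))
    [LocallyOfFiniteType X.hom] : QuasiSeparatedSpace X.left := by
  have := LocallyOfFiniteType.isLocallyNoetherian X.hom
  infer_instance

lemma compactSpace_tensor (X Y : Over (Spec (.of k))) [CompactSpace X.left] [CompactSpace Y.left] :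
    CompactSpace (X ⊗ Y).left :=
  have : QuasiCompact X.hom := (quasiCompact_iff_compactSpace _).2 ‹_›
  QuasiCompact.compactSpace_of_compactSpace (Limits.pullback.snd X.hom Y.hom)

lemma quasiSeparatedSpace_tensor (X Y : Over (Spec (.of k))) [QuasiSeparatedSpace X.left]
    [QuasiSeparatedSpace Y.left] : QuasiSeparatedSpace (X ⊗ Y).left :=
  have : QuasiSeparated X.hom := (quasiSeparated_iff_quasiSeparatedSpace _).2 ‹_›
  quasiSeparatedSpace_of_quasiSeparated (Limits.pullback.snd X.hom Y.hom)

/-- The functions on `Spec K`, viewed as a `k`-scheme, are the `k`-algebra `K`. -/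
noncomputable def functionsSpecEquiv (K : Type u) [Field K] [Algebra k K] :
    K ≃ₐ[k] functions (Over.mk (Spec.map (CommRingCat.ofHom (algebraMap k K)))) where
  __ := (Scheme.ΓSpecIso (.of K)).symm.commRingCatIsoToRingEquiv
  commutes' c := congrArg (fun q => q.hom c)
    (Scheme.ΓSpecIso_inv_naturality (CommRingCat.ofHom (algebraMap k K)))

/-- A connected group scheme that is smooth and of finite type over `k` becomes integral over an
algebraic closure of `k`, so its functions are geometrically a domain. -/
theorem isGeometricDomain_functions (G : Over (Spec (.of k))) [GrpObj G] [Smooth G.hom]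
    [LocallyOfFiniteType G.hom] [QuasiCompact G.hom] [ConnectedSpace G.left] :
    IsGeometricDomain k (functions G) := by
  let K := AlgebraicClosure k
  let g := Spec.map (CommRingCat.ofHom (algebraMap k K))
  let S : Over (Spec (.of k)) := Over.mk g
  have : ConnectedSpace ↥(Limits.pullback G.hom g) :=
    connectedSpace_pullback_of_isAlgebraic G.hom η[G].left (Over.w η[G]) K
  have : AlgebraicGeometry.IsReduced (Limits.pullback G.hom g) :=
    isReduced_of_smooth (Limits.pullback.snd G.hom g)
  have : CompactSpace ↥(Limits.pullback G.hom g) :=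
    QuasiCompact.compactSpace_of_compactSpace (Limits.pullback.snd G.hom g)
  let : GrpObj (Over.mk G.hom) := inferInstanceAs (GrpObj G)
  let : GrpObj (Over.mk (Limits.pullback.snd G.hom g)) := Over.grpObjMkPullbackSnd
  have : IrreducibleSpace ↥(Limits.pullback G.hom g) := by
    have : LocallyOfFiniteType (Over.mk (Limits.pullback.snd G.hom g)).hom :=
      inferInstanceAs (LocallyOfFiniteType (Limits.pullback.snd G.hom g))
    have : CompactSpace (Over.mk (Limits.pullback.snd G.hom g)).left :=
      inferInstanceAs (CompactSpace ↥(Limits.pullback G.hom g))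
    have : ConnectedSpace (Over.mk (Limits.pullback.snd G.hom g)).left :=
      inferInstanceAs (ConnectedSpace ↥(Limits.pullback G.hom g))
    exact irreducibleSpace_of_grpObj (Over.mk (Limits.pullback.snd G.hom g))
  have : AlgebraicGeometry.IsIntegral (Limits.pullback G.hom g) :=
    isIntegral_of_irreducibleSpace_of_isReduced _
  have : CompactSpace G.left := QuasiCompact.compactSpace_of_compactSpace G.hom
  have : QuasiSeparatedSpace G.left := quasiSeparatedSpace_of_locallyOfFiniteType G
  have : CompactSpace S.left := inferInstanceAs (CompactSpace ↥(Spec (.of K)))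
  have : QuasiSeparatedSpace S.left := inferInstanceAs (QuasiSeparatedSpace ↥(Spec (.of K)))
  have : IsDomain (functions (G ⊗ S)) :=
    inferInstanceAs (IsDomain Γ(Limits.pullback G.hom g, ⊤))
  let ε := AlgEquiv.ofBijective (kunneth G S) (kunneth_bijective G S)
  refine isGeometricDomain_of_isAlgClosure K ?_
  exact ((Algebra.TensorProduct.congr (functionsSpecEquiv K)
    AlgEquiv.refl).trans ε).toMulEquiv.isDomain

end Domain

end AlgCoh

/-! ### Units on `G × Y` -/

namespace AlgCoh

section Counit

variable {k : Type u} [Field k]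

lemma pullFun_comp {X Y Z : Over (Spec (.of k))} (φ : X ⟶ Y) (ψ : Y ⟶ Z) (f : functions Z) :
    pullFun (φ ≫ ψ) f = pullFun φ (pullFun ψ f) :=
  congrArg (fun q => q.hom f) (Scheme.Hom.comp_appTop φ.left ψ.left)

lemma pullFun_id (X : Over (Spec (.of k))) (f : functions X) : pullFun (𝟙 X) f = f :=
  congrArg (fun q => q.hom f) (Scheme.Hom.id_appTop (X := X.left))

lemma pull_id (X : Over (Spec (.of k))) (f : (functions X)ˣ) : pull (𝟙 X) f = f :=
  Units.ext (pullFun_id X f)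

lemma algebraMap_functions_unit_bijective :
    Function.Bijective (algebraMap k (functions (𝟙_ (Over (Spec (.of k)))))) := by
  have : ⇑(algebraMap k (functions (𝟙_ (Over (Spec (.of k)))))) =
      ⇑(Scheme.ΓSpecIso (.of k)).inv.hom :=
    funext fun c => congrArg (fun q => q.hom ((Scheme.ΓSpecIso (.of k)).inv.hom c))
      (Scheme.Hom.id_appTop (X := Spec (.of k)))
  rw [this]
  exact (Scheme.ΓSpecIso (.of k)).symm.commRingCatIsoToRingEquiv.bijective

variable (G : Over (Spec (.of k))) [GrpObj G]

/-- Evaluation of functions on `G` at the neutral element. -/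
noncomputable def counit : functions G →ₐ[k] k :=
  (AlgEquiv.ofBijective (Algebra.ofId k (functions (𝟙_ (Over (Spec (.of k))))))
    algebraMap_functions_unit_bijective).symm.toAlgHom.comp (pullAlgHom η[G])

/-- The constant morphism to the neutral element of `G`. -/
noncomputable def unitPoint (T : Over (Spec (.of k))) : T ⟶ G := toUnit T ≫ η[G]

variable {G}

lemma pullFun_unitPoint (T : Over (Spec (.of k))) (f : functions G) :
    pullFun (unitPoint G T) f = algebraMap k (functions T) (counit G f) := by
  have h : algebraMap k (functions (𝟙_ (Over (Spec (.of k))))) (counit G f) = pullFun η[G] f :=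
    (AlgEquiv.ofBijective (Algebra.ofId k (functions (𝟙_ (Over (Spec (.of k))))))
      algebraMap_functions_unit_bijective).apply_symm_apply (pullFun η[G] f)
  rw [unitPoint, pullFun_comp, ← h]
  exact (pullAlgHom (toUnit T)).commutes _

/-- Restriction to `{e} × Y` is, through the Künneth map, evaluation of the factor `k[G]` at `e`. -/
lemma pullFun_section_kunneth (Y : Over (Spec (.of k))) (x : functions Y ⊗[k] functions G) :
    pullFun (lift (unitPoint G Y) (𝟙 Y)) (kunneth G Y x) =
      evalRight (functions Y) (counit G) x := by
  induction x using TensorProduct.induction_on with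
  | zero => simp
  | add x y hx hy => simp only [map_add, hx, hy]
  | tmul a b =>
    rw [kunneth_tmul, map_mul, ← pullFun_comp, ← pullFun_comp, lift_fst, lift_snd, pullFun_id,
      pullFun_unitPoint, evalRight_tmul]

lemma lift_unitPoint_mul {T : Over (Spec (.of k))} (g : T ⟶ G) :
    lift (unitPoint G T) g ≫ μ[G] = g := by
  have h : lift (unitPoint G T) g = lift (toUnit T) g ≫ η[G] ▷ G := by simp [unitPoint]
  rw [h, Category.assoc, MonObj.one_mul]
  simp

lemma lift_mul_unitPoint {T : Over (Spec (.of k))} (g : T ⟶ G) :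
    lift g (unitPoint G T) ≫ μ[G] = g := by
  have h : lift g (unitPoint G T) = lift g (toUnit T) ≫ G ◁ η[G] := by simp [unitPoint]
  rw [h, Category.assoc, MonObj.mul_one]
  simp

lemma lift_unitPoint_act {X : Over (Spec (.of k))} [ModObj G X] {T : Over (Spec (.of k))}
    (x : T ⟶ X) : lift (unitPoint G T) x ≫ act G X = x := by
  have h : lift (unitPoint G T) x = lift (toUnit T) x ≫ η[G] ▷ X := by simp [unitPoint]
  have h1 : η[G] ▷ X ≫ act G X = (λ_ X).hom := ModObj.one_smul (M := G) X
  rw [h, Category.assoc, h1]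
  simp

lemma pull_character_mul (χ : characters G) {T : Over (Spec (.of k))} (a b : T ⟶ G) :
    pull (lift a b ≫ μ[G]) (χ : (functions G)ˣ) = pull a (χ : (functions G)ˣ) * pull b χ := by
  rw [pull_comp, χ.2, map_mul, ← pull_comp, ← pull_comp, lift_fst, lift_snd]

lemma pull_character_unitPoint (χ : characters G) (T : Over (Spec (.of k))) :
    pull (unitPoint G T) (χ : (functions G)ˣ) = 1 := by
  have h := pull_character_mul χ (unitPoint G T) (unitPoint G T)
  rw [lift_unitPoint_mul] at h
  exact left_eq_mul.1 h

/-- The restriction of `χ(g) α(y)` to `{e} × Y` is `α`. -/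
lemma pull_section_character_mul (χ : characters G) {Y : Over (Spec (.of k))}
    (α : (functions Y)ˣ) :
    pull (lift (unitPoint G Y) (𝟙 Y)) (pull (fst G Y) (χ : (functions G)ˣ) * pull (snd G Y) α) =
      α := by
  rw [map_mul, ← pull_comp, ← pull_comp, lift_fst, lift_snd, pull_id, pull_character_unitPoint,
    _root_.one_mul]

/-- A nonempty second factor makes pullback of functions from `X` to `X × Y` injective, even when
`Y` has no rational point. -/
lemma pullFun_fst_injective (X Y : Over (Spec (.of k))) [CompactSpace X.left]
    [QuasiSeparatedSpace X.left] [CompactSpace Y.left] [QuasiSeparatedSpace Y.left]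
    (hY : Function.Injective (algebraMap k (functions Y))) :
    Function.Injective (pullFun (fst X Y)) := by
  intro a b hab
  apply Algebra.TensorProduct.includeRight_injective (R := k) (A := functions Y) hY
  apply (kunneth_bijective X Y).injective
  change kunneth X Y (1 ⊗ₜ a) = kunneth X Y (1 ⊗ₜ b)
  simpa [kunneth_tmul] using hab

lemma pull_fst_injective (X Y : Over (Spec (.of k))) [CompactSpace X.left]
    [QuasiSeparatedSpace X.left] [CompactSpace Y.left] [QuasiSeparatedSpace Y.left]
    (hY : Function.Injective (algebraMap k (functions Y))) :
    Function.Injective (pull (fst X Y)) :=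
  Units.map_injective (pullFun_fst_injective X Y hY)

variable (G) in
lemma character_mul_injective [LocallyOfFiniteType G.hom] [QuasiCompact G.hom]
    {Y : Over (Spec (.of k))} [CompactSpace Y.left] [QuasiSeparatedSpace Y.left]
    (hY : IsIntegrallyClosedIn k (functions Y)) {χ χ' : characters G} {α α' : (functions Y)ˣ}
    (h : pull (fst G Y) (χ : (functions G)ˣ) * pull (snd G Y) α =
      pull (fst G Y) (χ' : (functions G)ˣ) * pull (snd G Y) α') : χ = χ' ∧ α = α' := by
  have h1 : α = α' := by
    rw [← pull_section_character_mul χ α, h, pull_section_character_mul]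
  have := QuasiCompact.compactSpace_of_compactSpace G.hom
  have := quasiSeparatedSpace_of_locallyOfFiniteType G
  refine ⟨Subtype.ext (pull_fst_injective G Y hY.algebraMap_injective ?_), h1⟩
  rw [h1] at h
  exact mul_right_cancel h

end Counit

section UnitsOnProduct

variable {k : Type u} [Field k] (G : Over (Spec (.of k))) [GrpObj G]
  [Smooth G.hom] [LocallyOfFiniteType G.hom] [QuasiCompact G.hom] [ConnectedSpace G.left]
  (Y : Over (Spec (.of k))) [CompactSpace Y.left] [QuasiSeparatedSpace Y.left]

/-- The Künneth isomorphism `k[Y] ⊗ k[G] ≅ k[G × Y]`. -/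
noncomputable def kunnethEquiv : functions Y ⊗[k] functions G ≃ₐ[k] functions (G ⊗ Y) :=
  have := QuasiCompact.compactSpace_of_compactSpace G.hom
  have := quasiSeparatedSpace_of_locallyOfFiniteType G
  AlgEquiv.ofBijective (kunneth G Y) (kunneth_bijective G Y)

variable {Y}

lemma isIntegrallyClosedIn_tensor (hY : IsIntegrallyClosedIn k (functions Y)) :
    IsIntegrallyClosedIn k (functions (G ⊗ Y)) :=
  (kunnethEquiv G Y).isIntegrallyClosedIn.1
    (isIntegrallyClosedIn_tensorProduct (isGeometricDomain_functions G) (counit G) hY)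

lemma isIntegrallyClosedIn_functions : IsIntegrallyClosedIn k (functions G) :=
  (Algebra.TensorProduct.lid k (functions G)).isIntegrallyClosedIn.1
    (isIntegrallyClosedIn_tensorProduct (isGeometricDomain_functions G) (counit G) inferInstance)

/-- An invertible function on `G × Y` that is `1` on `{e} × Y` comes from `G`. -/
lemma exists_pull_fst_eq (hY : IsIntegrallyClosedIn k (functions Y)) (w : (functions (G ⊗ Y))ˣ)
    (hw : pull (lift (unitPoint G Y) (𝟙 Y)) w = 1) :
    ∃ c : (functions G)ˣ, pull (fst G Y) c = w := by
  have key : ∀ w : (functions (G ⊗ Y))ˣ, pull (lift (unitPoint G Y) (𝟙 Y)) w = 1 →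
      ∃ c, pullFun (fst G Y) c = w := by
    intro w hw
    obtain ⟨x, hx⟩ := (kunnethEquiv G Y).surjective w
    have hxu : IsUnit x := (isUnit_map_iff (kunnethEquiv G Y) x).1 (hx ▸ w.isUnit)
    have hx1 : evalRight (functions Y) (counit G) x = 1 := by
      rw [← pullFun_section_kunneth]
      exact (congrArg _ hx).trans (congrArg Units.val hw)
    obtain ⟨c, rfl⟩ := exists_eq_one_tmul_of_isUnit (isGeometricDomain_functions G) (counit G)
      hY hxu hx1
    refine ⟨c, ?_⟩
    rw [← hx]
    change pullFun (fst G Y) c = kunneth G Y (1 ⊗ₜ c)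
    rw [kunneth_tmul, map_one, _root_.one_mul]
  obtain ⟨c, hc⟩ := key w hw
  obtain ⟨d, hd⟩ := key w⁻¹ (by rw [map_inv, hw, inv_one])
  have := QuasiCompact.compactSpace_of_compactSpace G.hom
  have := quasiSeparatedSpace_of_locallyOfFiniteType G
  have hcd : c * d = 1 := pullFun_fst_injective G Y hY.algebraMap_injective
    (by rw [map_mul, hc, hd, map_one, w.mul_inv])
  exact ⟨⟨c, d, hcd, by rw [mul_comm, hcd]⟩, Units.ext hc⟩

/-- Rosenlicht's theorem: an invertible function on `G` with value `1` at `e` is a character,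
because `χ(g h) / (χ(g) χ(h))` is `1` on `{e} × G` and on `G × {e}`. -/
lemma mem_characters_of_pull_unitPoint (χ : (functions G)ˣ) (hχ : pull (unitPoint G G) χ = 1) :
    χ ∈ characters G := by
  have := QuasiCompact.compactSpace_of_compactSpace G.hom
  have := quasiSeparatedSpace_of_locallyOfFiniteType G
  have hG := isIntegrallyClosedIn_functions G
  set w := pull μ[G] χ * (pull (fst G G) χ * pull (snd G G) χ)⁻¹ with hw
  obtain ⟨c, hc⟩ := exists_pull_fst_eq G hG w (by
    simp only [hw, map_mul, map_inv, ← pull_comp, lift_unitPoint_mul, lift_fst, lift_snd, pull_id,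
      hχ]
    simp)
  have h1 : pull (lift (𝟙 G) (unitPoint G G)) w = 1 := by
    simp only [hw, map_mul, map_inv, ← pull_comp, lift_mul_unitPoint, lift_fst, lift_snd, pull_id,
      hχ]
    simp
  rw [← hc, ← pull_comp, lift_fst, pull_id] at h1
  rw [h1, map_one] at hc
  exact mul_inv_eq_one.1 hc.symm

/-- An invertible function on `G × Y` is `χ(g) α(y)` with a character `χ` of `G` and `α` its
restriction to `{e} × Y`. -/
theorem exists_character_mul (hY : IsIntegrallyClosedIn k (functions Y))
    (u : (functions (G ⊗ Y))ˣ) :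
    ∃ χ : characters G, u = pull (fst G Y) (χ : (functions G)ˣ) *
      pull (snd G Y) (pull (lift (unitPoint G Y) (𝟙 Y)) u) := by
  set s := lift (unitPoint G Y) (𝟙 Y)
  obtain ⟨c, hc⟩ := exists_pull_fst_eq G hY (u * (pull (snd G Y) (pull s u))⁻¹) (by
    rw [map_mul, map_inv, ← pull_comp s, lift_snd, pull_id, mul_inv_cancel])
  have hc1 : pull (unitPoint G G) c = 1 := by
    -- the value of `c` at `e` may be computed in `k[Y]`, where `k` embeds
    have h1 : pull (unitPoint G Y) c = 1 := by
      have h2 := congrArg (pull s) hc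
      rwa [← pull_comp, lift_fst, map_mul, map_inv, ← pull_comp s, lift_snd, pull_id,
        mul_inv_cancel] at h2
    have h3 : counit G c = 1 := by
      apply hY.algebraMap_injective
      rw [← pullFun_unitPoint, map_one]
      exact congrArg Units.val h1
    refine Units.ext ?_
    change pullFun (unitPoint G G) c = 1
    rw [pullFun_unitPoint, h3, map_one]
  refine ⟨⟨c, mem_characters_of_pull_unitPoint G c hc1⟩, ?_⟩
  rw [hc, inv_mul_cancel_right]

end UnitsOnProduct

end AlgCoh

/-! ### Units on `Gⁿ × X` -/

namespace AlgCoh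

section Bar

variable {k : Type u} [Field k] (G X : Over (Spec (.of k)))

/-- `G⁰ × X` is `X`. -/
noncomputable def barZeroIso : bar G X 0 ≅ X where
  hom := base G X 0
  inv := toBar Fin.elim0 (𝟙 X)
  hom_inv_id := bar_hom_ext (fun j => j.elim0) (by simp)
  inv_hom_id := by simp

/-- `G^{n+1} × X` is `G × (Gⁿ × X)`, splitting off the coordinate `g_n`. -/
noncomputable def barSuccIso (n : ℕ) : bar G X (n + 1) ≅ G ⊗ bar G X n where
  hom := lift (coord G X (Fin.last n))
    (toBar (fun j => coord G X j.castSucc) (base G X (n + 1)))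
  inv := toBar (Fin.snoc (fun j => snd G (bar G X n) ≫ coord G X j) (fst G (bar G X n)))
    (snd G (bar G X n) ≫ base G X n)
  hom_inv_id := by
    refine bar_hom_ext (fun j => ?_) (by simp)
    refine Fin.lastCases ?_ (fun j => ?_) j <;> simp
  inv_hom_id := by
    refine CartesianMonoidalCategory.hom_ext _ _ (by simp) ?_
    exact bar_hom_ext (fun j => by simp) (by simp)

lemma compactSpace_of_iso {Y Z : Over (Spec (.of k))} (φ : Y ≅ Z) [CompactSpace Z.left] :
    CompactSpace Y.left :=
  have e : Y.left ≃ₜ Z.left := Scheme.homeoOfIso ((Over.forget _).mapIso φ)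
  e.symm.compactSpace

lemma quasiSeparatedSpace_of_iso {Y Z : Over (Spec (.of k))} (φ : Y ≅ Z)
    [QuasiSeparatedSpace Z.left] : QuasiSeparatedSpace Y.left :=
  (quasiSeparatedSpace_congr (Scheme.homeoOfIso ((Over.forget _).mapIso φ))).2 ‹_›

lemma pull_injective_of_iso {Y Z : Over (Spec (.of k))} (φ : Y ≅ Z) :
    Function.Injective (pull φ.hom) := fun a b h => by
  rw [← pull_id Z a, ← pull_id Z b, ← φ.inv_hom_id, pull_comp, h, ← pull_comp]

lemma isIntegrallyClosedIn_of_iso {Y Z : Over (Spec (.of k))} (φ : Y ≅ Z)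
    (hZ : IsIntegrallyClosedIn k (functions Z)) : IsIntegrallyClosedIn k (functions Y) :=
  AlgHom.isIntegrallyClosedIn (pullAlgHom φ.inv) (fun a b h => by
    have h' : pullFun φ.inv a = pullFun φ.inv b := h
    rw [← pullFun_id Y a, ← pullFun_id Y b, ← φ.hom_inv_id, pullFun_comp, h', ← pullFun_comp]) hZ

variable [GrpObj G]

/-- The map `(χ_{n-1}, …, χ₀, α) ↦ χ_{n-1}(g_{n-1}) ⋯ χ₀(g₀) α(x)` as a homomorphism. -/
noncomputable def prodUnitHom (n : ℕ) :
    (Fin n → characters G) × (functions X)ˣ →* (functions (bar G X n))ˣ where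
  toFun p := prodUnit G X p.1 p.2
  map_one' := by simp [prodUnit]
  map_mul' p q := by
    simp only [prodUnit, Prod.fst_mul, Prod.snd_mul, Pi.mul_apply, Subgroup.coe_mul, map_mul,
      Finset.prod_mul_distrib]
    exact _root_.mul_mul_mul_comm _ _ _ _

lemma prodUnitHom_apply {n : ℕ} (p : (Fin n → characters G) × (functions X)ˣ) :
    prodUnitHom G X n p = prodUnit G X p.1 p.2 := rfl

lemma prodUnit_zero (c : Fin 0 → characters G) (α : (functions X)ˣ) :
    prodUnit G X c α = pull (barZeroIso G X).hom α := by
  simp [prodUnit, barZeroIso]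

lemma prodUnit_succ {n : ℕ} (c : Fin (n + 1) → characters G) (α : (functions X)ˣ) :
    prodUnit G X c α = pull (barSuccIso G X n).hom
      (pull (fst G (bar G X n)) (c (Fin.last n) : (functions G)ˣ) *
        pull (snd G (bar G X n)) (prodUnit G X (fun j => c j.castSucc) α)) := by
  simp only [prodUnit, barSuccIso, map_mul, map_prod, ← pull_comp, lift_fst, lift_snd_assoc,
    toBar_coord, toBar_base, Fin.prod_univ_castSucc]
  rw [← _root_.mul_assoc, mul_comm (pull _ (c (Fin.last n) : (functions G)ˣ))]

variable [Smooth G.hom] [LocallyOfFiniteType G.hom] [QuasiCompact G.hom] [ConnectedSpace G.left]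
  [CompactSpace X.left] [QuasiSeparatedSpace X.left]

lemma bar_qcqs_and_isIntegrallyClosedIn (hX : IsIntegrallyClosedIn k (functions X)) (n : ℕ) :
    CompactSpace (bar G X n).left ∧ QuasiSeparatedSpace (bar G X n).left ∧
      IsIntegrallyClosedIn k (functions (bar G X n)) := by
  induction n with
  | zero =>
    exact ⟨compactSpace_of_iso (barZeroIso G X), quasiSeparatedSpace_of_iso (barZeroIso G X),
      isIntegrallyClosedIn_of_iso (barZeroIso G X) hX⟩
  | succ n ih =>
    obtain ⟨_, _, h⟩ := ih
    have := QuasiCompact.compactSpace_of_compactSpace G.hom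
    have := quasiSeparatedSpace_of_locallyOfFiniteType G
    have := compactSpace_tensor G (bar G X n)
    have := quasiSeparatedSpace_tensor G (bar G X n)
    exact ⟨compactSpace_of_iso (barSuccIso G X n), quasiSeparatedSpace_of_iso (barSuccIso G X n),
      isIntegrallyClosedIn_of_iso (barSuccIso G X n) (isIntegrallyClosedIn_tensor G h)⟩

/-- Invertible functions on `Gⁿ × X` factor uniquely into characters of the coordinates in `G` and
an invertible function on `X`. -/
theorem prodUnitHom_bijective (hX : IsIntegrallyClosedIn k (functions X)) (n : ℕ) :
    Function.Bijective (prodUnitHom G X n) := by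
  induction n with
  | zero =>
    refine ⟨fun p q h => Prod.ext (Subsingleton.elim _ _) ?_, fun u => ?_⟩
    · refine pull_injective_of_iso (barZeroIso G X) ?_
      rw [← prodUnit_zero, ← prodUnit_zero]
      exact h
    · refine ⟨(Fin.elim0, pull (barZeroIso G X).inv u), ?_⟩
      change prodUnit G X _ _ = u
      rw [prodUnit_zero, ← pull_comp, Iso.hom_inv_id, pull_id]
  | succ n ih =>
    obtain ⟨_, _, hn⟩ := bar_qcqs_and_isIntegrallyClosedIn G X hX n
    refine ⟨?_, fun u => ?_⟩
    · rintro ⟨c, α⟩ ⟨c', α'⟩ h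
      change prodUnit G X c α = prodUnit G X c' α' at h
      rw [prodUnit_succ, prodUnit_succ] at h
      obtain ⟨h1, h2⟩ := character_mul_injective G hn (pull_injective_of_iso _ h)
      have h3 := ih.1 (a₁ := (fun j => c j.castSucc, α)) (a₂ := (fun j => c' j.castSucc, α')) h2
      rw [Prod.mk.injEq] at h3 ⊢
      exact ⟨funext (Fin.lastCases h1 fun j => congrFun h3.1 j), h3.2⟩
    · obtain ⟨χ, hχ⟩ := exists_character_mul G hn (pull (barSuccIso G X n).inv u)
      obtain ⟨⟨c, α⟩, hc⟩ := ih.2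
        (pull (lift (unitPoint G _) (𝟙 _)) (pull (barSuccIso G X n).inv u))
      refine ⟨(Fin.snoc c χ, α), ?_⟩
      change prodUnit G X c α = _ at hc
      change prodUnit G X (Fin.snoc c χ : Fin (n + 1) → characters G) α = u
      rw [prodUnit_succ]
      simp only [Fin.snoc_last, Fin.snoc_castSucc]
      rw [hc, ← hχ, ← pull_comp, Iso.hom_inv_id, pull_id]

variable {G X}

lemma exists_prodUnit (hX : IsIntegrallyClosedIn k (functions X)) {n : ℕ}
    (u : (functions (bar G X n))ˣ) :
    ∃ (c : Fin n → characters G) (α : (functions X)ˣ), prodUnit G X c α = u := by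
  obtain ⟨p, hp⟩ := (prodUnitHom_bijective G X hX n).2 u
  exact ⟨p.1, p.2, hp⟩

lemma prodUnit_inj (hX : IsIntegrallyClosedIn k (functions X)) {n : ℕ}
    {c c' : Fin n → characters G} {α α' : (functions X)ˣ} :
    prodUnit G X c α = prodUnit G X c' α' ↔ c = c' ∧ α = α' := by
  rw [← Prod.mk.injEq]
  exact (prodUnitHom_bijective G X hX n).1.eq_iff (a := (c, α)) (b := (c', α'))

lemma prodUnit_eq_one_iff (hX : IsIntegrallyClosedIn k (functions X)) {n : ℕ}
    {c : Fin n → characters G} {α : (functions X)ˣ} :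
    prodUnit G X c α = 1 ↔ (∀ l, c l = 1) ∧ α = 1 := by
  rw [← map_one (prodUnitHom G X n), ← funext_iff (g := fun _ => 1)]
  exact prodUnit_inj hX

end Bar

end AlgCoh

/-! ### The complex of units and its cohomology -/

namespace AlgCoh

section Combinatorics

lemma prod_range_zpow_neg_one_pow {A : Type*} [CommGroup A] (b : A) (N : ℕ) :
    ∏ i ∈ Finset.range N, b ^ ((-1 : ℤ) ^ i) = if Even N then 1 else b := by
  induction N with
  | zero => simp
  | succ N ih =>
    rw [Finset.prod_range_succ, ih]
    by_cases h : Even N <;> simp [h, Nat.even_add_one, Nat.not_even_iff_odd.1, Odd.neg_one_pow]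

lemma prod_range_ite_zpow_neg_one_pow {A : Type*} [CommGroup A] (a b : A) {l N : ℕ} (hl : l < N) :
    ∏ i ∈ Finset.range N, (if l < i then b else a) ^ ((-1 : ℤ) ^ i) =
      (if Even l then a / b else 1) * if Even N then 1 else b := by
  induction N, Nat.succ_le_of_lt hl using Nat.le_induction with
  | base =>
    rw [Finset.prod_congr rfl (g := fun i => a ^ ((-1 : ℤ) ^ i)), prod_range_zpow_neg_one_pow]
    · by_cases h : Even l <;> simp [h, Nat.even_add_one]
    · intro i hi
      rw [if_neg (by have := Finset.mem_range.1 hi; omega)]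
  | succ N hN ih =>
    rw [Finset.prod_range_succ, ih hN, if_pos (show l < N from hN)]
    by_cases h : Even N <;>
      simp [h, Nat.even_add_one, Nat.not_even_iff_odd.1, Odd.neg_one_pow, div_eq_mul_inv]

/-- The sequence `a, c₀, …, c_{n-1}, 1, 1, …`. -/
def extend {A : Type*} [One A] (a : A) {n : ℕ} (c : Fin n → A) : ℕ → A
  | 0 => a
  | j + 1 => if h : j < n then c ⟨j, h⟩ else 1

variable {A : Type*} [One A] (a : A) {n : ℕ} (c : Fin n → A)

@[simp] lemma extend_zero : extend a c 0 = a := rfl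

lemma extend_succ {j : ℕ} (h : j < n) : extend a c (j + 1) = c ⟨j, h⟩ := dif_pos h

@[simp] lemma extend_succ_val (j : Fin n) : extend a c (j + 1) = c j := dif_pos j.2

@[simp] lemma extend_self_succ : extend a c (n + 1) = 1 := dif_neg (lt_irrefl n)

end Combinatorics

section Cohomology

variable {k : Type u} [Field k] {G X : Over (Spec (.of k))} [GrpObj G] [ModObj G X]

lemma pull_face_coord {n : ℕ} (i : Fin (n + 2)) (j : Fin n) (χ : characters G) :
    pull (face G X n i) (pull (coord G X j) (χ : (functions G)ˣ)) =
      (if (j : ℕ) < i then pull (coord G X j.castSucc) (χ : (functions G)ˣ) else 1) *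
        if (j : ℕ) + 1 < i then 1 else pull (coord G X j.succ) (χ : (functions G)ˣ) := by
  rw [← pull_comp, face_coord]
  split_ifs <;> first | omega | skip
  · rw [_root_.mul_one]
  · rw [pull_character_mul, _root_.mul_comm]
  · rw [_root_.one_mul]

lemma pull_face_base {n : ℕ} (i : Fin (n + 2)) {χ : characters G} {α : (functions X)ˣ}
    (h : IsSemiInvariant G X χ α) :
    pull (face G X n i) (pull (base G X n) α) =
      (if 0 < (i : ℕ) then 1 else pull (coord G X 0) (χ : (functions G)ˣ)) *
        pull (base G X (n + 1)) α := by
  rw [← pull_comp, face_base]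
  by_cases hi : i = 0
  · subst hi
    rw [if_pos rfl, pull_comp, h, map_mul, ← pull_comp, ← pull_comp, lift_fst, lift_snd]
    simp
  · rw [if_neg hi, if_pos (Nat.pos_of_ne_zero fun h => hi (Fin.ext h)), _root_.one_mul]

/-- In the pullback of `χ_{n-1}(g_{n-1}) ⋯ χ₀(g₀) α(x)` along `dᵢ`, the character at `g_l` is the
`l`-th entry, counted from `0`, of the sequence `χ, χ₀, …, χ_{n-1}, 1` if `i ≤ l`, and the next entry
if `l < i`; here `χ` is the character of `α`. -/
lemma pull_face_prodUnit {n : ℕ} (i : Fin (n + 2)) (c : Fin n → characters G) {χ : characters G}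
    {α : (functions X)ˣ} (h : IsSemiInvariant G X χ α) :
    pull (face G X n i) (prodUnit G X c α) = prodUnit G X
      (fun l : Fin (n + 1) => if (l : ℕ) < i then extend χ c (l + 1) else extend χ c l) α := by
  have hsplit : ∀ l : Fin (n + 1), pull (coord G X l)
      ↑(if (l : ℕ) < i then extend χ c (l + 1) else extend χ c l) =
      (if (l : ℕ) < i then pull (coord G X l) (↑(extend χ c (l + 1)) : (functions G)ˣ) else 1) *
        if (l : ℕ) < i then 1 else pull (coord G X l) (↑(extend χ c l) : (functions G)ˣ) := by
    intro l
    split_ifs <;> simp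
  simp only [prodUnit, map_mul, map_prod, pull_face_coord, pull_face_base i h, hsplit,
    Finset.prod_mul_distrib]
  rw [Fin.prod_univ_castSucc (n := n), Fin.prod_univ_succ (n := n)]
  simp only [Fin.val_castSucc, Fin.val_last, Fin.val_succ, Fin.val_zero, extend_succ_val,
    extend_self_succ, extend_zero, OneMemClass.coe_one, map_one, ite_self, _root_.mul_one]
  ac_rfl

/-- The coboundary in terms of the factorization of units. At the coordinate `g_l` the faces `dᵢ`
with `i ≤ l` contribute the `l`-th entry of `χ, χ₀, …, χ_{n-1}, 1` and those with `i > l` the next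
one, with alternating signs. -/
lemma coboundary_prodUnit {n : ℕ} (c : Fin n → characters G) {χ : characters G}
    {α : (functions X)ˣ} (h : IsSemiInvariant G X χ α) :
    coboundary G X n (prodUnit G X c α) = prodUnit G X
      (fun l : Fin (n + 1) =>
        (if Even (l : ℕ) then extend χ c l / extend χ c (l + 1) else 1) *
          if Even n then 1 else extend χ c (l + 1))
      (if Even n then 1 else α) := by
  have key : coboundary G X n (prodUnit G X c α) = prodUnitHom G X (n + 1)
      (∏ i : Fin (n + 2), ((fun l : Fin (n + 1) =>
        if (l : ℕ) < i then extend χ c (l + 1) else extend χ c l, α) :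
          (Fin (n + 1) → characters G) × (functions X)ˣ) ^ ((-1 : ℤ) ^ (i : ℕ))) := by
    rw [map_prod, coboundary_apply]
    refine Finset.prod_congr rfl fun i _ => ?_
    rw [map_zpow, pull_face_prodUnit i c h]
    rfl
  rw [key, prodUnitHom_apply]
  refine congrArg₂ (prodUnit G X) (funext fun l => ?_) ?_
  · rw [Prod.fst_prod, Finset.prod_apply]
    simp only [Prod.pow_fst, Pi.pow_apply]
    rw [Fin.prod_univ_eq_prod_range (fun i => (if (l : ℕ) < i then extend χ c (l + 1)
      else extend χ c l) ^ ((-1 : ℤ) ^ i)), prod_range_ite_zpow_neg_one_pow _ _ (by omega)]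
    simp [Nat.even_add]
  · rw [Prod.snd_prod]
    simp only [Prod.pow_snd]
    rw [Fin.prod_univ_eq_prod_range (fun i => α ^ ((-1 : ℤ) ^ i)), prod_range_zpow_neg_one_pow]
    simp [Nat.even_add]

lemma coboundary_prodUnit_of_even {n : ℕ} (hn : Even n) (c : Fin n → characters G)
    {χ : characters G} {α : (functions X)ˣ} (h : IsSemiInvariant G X χ α) :
    coboundary G X n (prodUnit G X c α) = prodUnit G X
      (fun l : Fin (n + 1) =>
        if Even (l : ℕ) then extend χ c l / extend χ c (l + 1) else 1) 1 := by
  simp only [coboundary_prodUnit c h, if_pos hn, _root_.mul_one]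

lemma coboundary_prodUnit_of_odd {n : ℕ} (hn : Odd n) (c : Fin n → characters G)
    {χ : characters G} {α : (functions X)ˣ} (h : IsSemiInvariant G X χ α) :
    coboundary G X n (prodUnit G X c α) = prodUnit G X
      (fun l : Fin (n + 1) =>
        if Even (l : ℕ) then extend χ c l else extend χ c (l + 1)) α := by
  simp only [coboundary_prodUnit c h, if_neg (Nat.not_even_iff_odd.2 hn), ite_mul, div_mul_cancel,
    _root_.one_mul]

lemma isSemiInvariant_one : IsSemiInvariant G X (1 : characters G) (1 : (functions X)ˣ) := by
  simp [IsSemiInvariant]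

lemma isSemiInvariant_one_iff {α : (functions X)ˣ} :
    IsSemiInvariant G X (1 : characters G) α ↔ (α : functions X) ∈ invariants G X := by
  simp only [IsSemiInvariant, OneMemClass.coe_one, map_one, _root_.one_mul, Units.ext_iff]
  rfl

lemma IsSemiInvariant.character_unique [LocallyOfFiniteType G.hom] [QuasiCompact G.hom]
    [CompactSpace X.left] [QuasiSeparatedSpace X.left]
    (hX : IsIntegrallyClosedIn k (functions X))
    {χ χ' : characters G} {α : (functions X)ˣ} (h : IsSemiInvariant G X χ α)
    (h' : IsSemiInvariant G X χ' α) : χ = χ' :=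
  (character_mul_injective G hX (h.symm.trans h')).1

variable [Smooth G.hom] [LocallyOfFiniteType G.hom] [QuasiCompact G.hom] [ConnectedSpace G.left]
  [CompactSpace X.left] [QuasiSeparatedSpace X.left]

/-- Every invertible function on `X` is semi-invariant. -/
lemma exists_isSemiInvariant (hX : IsIntegrallyClosedIn k (functions X)) (α : (functions X)ˣ) :
    ∃ χ : characters G, IsSemiInvariant G X χ α := by
  obtain ⟨χ, hχ⟩ := exists_character_mul G hX (pull (act G X) α)
  refine ⟨χ, ?_⟩
  rwa [← pull_comp _ (act G X), lift_unitPoint_act, pull_id] at hχ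

lemma prodUnit_mem_cocycles_of_even (hX : IsIntegrallyClosedIn k (functions X)) {n : ℕ}
    (hn : Even n) (c : Fin n → characters G) {χ : characters G} {α : (functions X)ˣ}
    (h : IsSemiInvariant G X χ α) :
    prodUnit G X c α ∈ cocycles G X n ↔
      ∀ l ≤ n, Even l → extend χ c l = extend χ c (l + 1) := by
  rw [cocycles, MonoidHom.mem_ker, coboundary_prodUnit_of_even hn c h, prodUnit_eq_one_iff hX]
  simp only [ite_eq_right_iff, div_eq_one, Fin.forall_iff, and_true, Nat.lt_succ_iff]

lemma prodUnit_mem_cocycles_zero (hX : IsIntegrallyClosedIn k (functions X))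
    (c : Fin 0 → characters G) (α : (functions X)ˣ) :
    prodUnit G X c α ∈ cocycles G X 0 ↔ (α : functions X) ∈ invariants G X := by
  obtain ⟨χ, hχ⟩ := exists_isSemiInvariant (G := G) hX α
  rw [prodUnit_mem_cocycles_of_even hX Even.zero c hχ, ← isSemiInvariant_one_iff]
  constructor
  · intro h
    have := h 0 le_rfl Even.zero
    rw [extend_zero, extend_self_succ] at this
    rwa [← this]
  · intro h l hl _
    obtain rfl := Nat.le_zero.1 hl
    rw [extend_zero, extend_self_succ]
    exact hχ.character_unique hX h

theorem prodUnit_mem_cocycles_even (hX : IsIntegrallyClosedIn k (functions X)) (m : ℕ)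
    (c : Fin (2 * m + 2) → characters G) (α : (functions X)ˣ) :
    prodUnit G X c α ∈ cocycles G X (2 * m + 2) ↔
      IsSemiInvariant G X (c 0) α ∧
      (∀ (i : ℕ) (hi : i < m), c ⟨2 * i + 1, by omega⟩ = c ⟨2 * i + 2, by omega⟩) ∧
      c (Fin.last (2 * m + 1)) = 1 := by
  obtain ⟨χ, hχ⟩ := exists_isSemiInvariant (G := G) hX α
  rw [prodUnit_mem_cocycles_of_even hX (by simp [Nat.even_add]) c hχ]
  constructor
  · intro h
    refine ⟨?_, fun i hi => ?_, ?_⟩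
    · have := h 0 (by omega) Even.zero
      rw [extend_zero, extend_succ _ _ (by omega)] at this
      exact this ▸ hχ
    · have := h (2 * i + 2) (by omega) (by simp [Nat.even_add])
      rwa [extend_succ _ _ (by omega), extend_succ _ _ (by omega)] at this
    · have := h (2 * m + 2) le_rfl (by simp [Nat.even_add])
      rwa [extend_succ _ _ (by omega), extend_self_succ] at this
  · rintro ⟨h0, h1, h2⟩ l hl hl'
    obtain ⟨j, rfl⟩ := hl'.two_dvd
    rcases j with _ | j
    · rw [extend_succ _ _ (by omega)]
      exact hχ.character_unique hX h0
    · rcases (show j ≤ m by omega).lt_or_eq with hj | rfl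
      · have := h1 j hj
        rw [extend_succ _ _ (by omega : 2 * (j + 1) < _)]
        exact (extend_succ _ _ (by omega : 2 * j + 1 < _)).trans this
      · refine Eq.trans (extend_succ _ _ (by omega : 2 * j + 1 < _)) (h2.trans ?_)
        exact (extend_self_succ _ _).symm

theorem prodUnit_mem_cocycles_odd (hX : IsIntegrallyClosedIn k (functions X)) (m : ℕ)
    (c : Fin (2 * m + 1) → characters G) (α : (functions X)ˣ) :
    prodUnit G X c α ∈ cocycles G X (2 * m + 1) ↔
      α = 1 ∧ ∀ (i : ℕ) (hi : i < m), c ⟨2 * i + 1, by omega⟩ = 1 := by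
  obtain ⟨χ, hχ⟩ := exists_isSemiInvariant (G := G) hX α
  rw [cocycles, MonoidHom.mem_ker, coboundary_prodUnit_of_odd (by simp) c hχ,
    prodUnit_eq_one_iff hX, and_comm]
  refine and_congr_right fun hα => ⟨fun h i hi => ?_, fun h l => ?_⟩
  · have := h ⟨2 * i + 1, by omega⟩
    rwa [if_neg (by simp), extend_succ _ _ (by dsimp only; omega)] at this
  · have key : ∀ j ≤ m + 1, extend χ c (2 * j) = 1 := by
      rintro (_ | j) hj
      · subst hα
        exact hχ.character_unique hX isSemiInvariant_one
      · rcases (show j ≤ m by omega).lt_or_eq with hj | rfl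
        · exact (extend_succ _ _ (by omega : 2 * j + 1 < _)).trans (h j hj)
        · exact extend_self_succ χ c
    split_ifs with hl
    · obtain ⟨j, hj⟩ := hl.two_dvd
      rw [hj]
      exact key j (by omega)
    · obtain ⟨j, hj⟩ := Nat.not_even_iff_odd.1 hl
      rw [hj]
      exact key (j + 1) (by omega)

theorem coboundaries_eq_cocycles_even (hX : IsIntegrallyClosedIn k (functions X)) (m : ℕ) :
    coboundaries G X (2 * m + 2) = cocycles G X (2 * m + 2) := by
  refine (coboundaries_le_cocycles G X _).antisymm fun u hu => ?_
  obtain ⟨c, α, rfl⟩ := exists_prodUnit hX u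
  obtain ⟨h0, h1, h2⟩ := (prodUnit_mem_cocycles_even hX m c α).1 hu
  -- omitting the last entry, which is `1`, gives a preimage
  refine ⟨prodUnit G X (fun j => c j.castSucc) α, ?_⟩
  rw [coboundary_prodUnit_of_odd (by simp) _ h0]
  refine congrArg (prodUnit G X · α) (funext fun l => ?_)
  split_ifs with hl
  · obtain ⟨j, hj⟩ := hl.two_dvd
    obtain ⟨l, hl⟩ := l
    dsimp only at hj
    subst hj
    rcases j with _ | j
    · rfl
    · exact (extend_succ _ _ (by omega : 2 * j + 1 < _)).trans (h1 j (by omega))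
  · refine Fin.lastCases ?_ (fun l => ?_) l
    · rw [h2]
      exact extend_self_succ _ _
    · exact extend_succ_val _ _ l

theorem coboundaries_eq_cocycles_odd (hX : IsIntegrallyClosedIn k (functions X)) (m : ℕ) :
    coboundaries G X (2 * m + 3) = cocycles G X (2 * m + 3) := by
  refine (coboundaries_le_cocycles G X _).antisymm fun u hu => ?_
  obtain ⟨c, α, rfl⟩ := exists_prodUnit hX u
  obtain ⟨rfl, h⟩ := (prodUnit_mem_cocycles_odd hX (m + 1) c α).1 hu
  -- the coboundary has `d (2 * i - 1) / d (2 * i)` at `g_{2i}`, where `d` out of range means `1`: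
  -- the last entry of `d` accounts for `c (2 * m + 2)`, the even ones for the other `c (2 * i)`
  refine ⟨prodUnit G X (Fin.snoc (fun j : Fin (2 * m + 1) => (c (j.castLE (by omega)))⁻¹)
    (c (Fin.last _)) : Fin (2 * m + 2) → characters G) 1, ?_⟩
  rw [coboundary_prodUnit_of_even (by simp [Nat.even_add]) _ isSemiInvariant_one]
  refine congrArg (prodUnit G X · 1) (funext fun l => ?_)
  have hc : ∀ (j : ℕ) (hj : j < 2 * m + 1), extend 1 (Fin.snoc (fun j : Fin (2 * m + 1) =>
      (c (j.castLE (by omega)))⁻¹) (c (Fin.last _)) : Fin (2 * m + 2) → characters G) (j + 1) =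
      (c ⟨j, by omega⟩)⁻¹ := fun j hj =>
    (extend_succ _ _ (by omega)).trans (Fin.snoc_castSucc (α := fun _ => characters G) _ _ ⟨j, hj⟩)
  obtain ⟨l, hl⟩ := l
  dsimp only
  split_ifs with hl'
  · obtain ⟨j, rfl⟩ := hl'.two_dvd
    rcases j with _ | j
    · rw [hc _ (by omega)]
      change 1 / _ = _
      rw [one_div, inv_inv]
    · rcases (show j ≤ m by omega).lt_or_eq with hj | rfl
      · rw [hc _ (by omega)]
        have := hc (2 * j + 1) (by omega)
        rw [h j (by omega), inv_one] at this
        refine (congrArg (· / _) this).trans ?_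
        rw [one_div, inv_inv]
      · refine (congrArg₂ (· / ·) (extend_succ _ _ (by omega : 2 * j + 1 < _))
          (extend_self_succ _ _)).trans ?_
        rw [div_one]
        exact Fin.snoc_last (α := fun _ => characters G) _ _
  · obtain ⟨j, rfl⟩ := Nat.not_even_iff_odd.1 hl'
    exact (h j (by omega)).symm

theorem prodUnit_mem_coboundaries_one (hX : IsIntegrallyClosedIn k (functions X))
    (c : Fin 1 → characters G) (α : (functions X)ˣ) :
    prodUnit G X c α ∈ coboundaries G X 1 ↔ α = 1 ∧ c 0 ∈ semiCharacters G X := by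
  constructor
  · rintro ⟨u, hu⟩
    obtain ⟨d, β, rfl⟩ := exists_prodUnit hX u
    obtain ⟨χ, hχ⟩ := exists_isSemiInvariant (G := G) hX β
    obtain ⟨rfl, rfl⟩ := (prodUnit_inj hX).1
      ((coboundary_prodUnit_of_even Even.zero d hχ).symm.trans hu)
    refine ⟨rfl, β, ?_⟩
    simpa [extend] using hχ
  · rintro ⟨rfl, β, hβ⟩
    refine ⟨prodUnit G X Fin.elim0 β, (coboundary_prodUnit_of_even Even.zero _ hβ).trans ?_⟩
    refine congrArg (prodUnit G X · 1) (funext fun l => ?_)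
    obtain rfl : l = 0 := Subsingleton.elim (α := Fin 1) l 0
    simp [extend]

lemma mem_cocycles_zero_iff (hX : IsIntegrallyClosedIn k (functions X))
    (u : (functions (bar G X 0))ˣ) : u ∈ cocycles G X 0 ↔
      ∃ f : (invariants G X)ˣ, u = pull (base G X 0)
        (Units.map ((invariants G X).subtype : _ →* functions X) f) := by
  constructor
  · intro hu
    obtain ⟨c, α, rfl⟩ := exists_prodUnit hX u
    have h := (prodUnit_mem_cocycles_zero hX c α).1 hu
    have h' := (prodUnit_mem_cocycles_zero hX c⁻¹ α⁻¹).1 (by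
      have := inv_mem hu
      rwa [show (prodUnit G X c α)⁻¹ = prodUnit G X c⁻¹ α⁻¹ from
        (map_inv (prodUnitHom G X 0) (c, α)).symm] at this)
    refine ⟨⟨⟨α, h⟩, ⟨_, h'⟩, Subtype.ext α.mul_inv, Subtype.ext α.inv_mul⟩, ?_⟩
    rw [prodUnit_zero]
    exact congrArg (pull (base G X 0)) (Units.ext rfl)
  · rintro ⟨f, rfl⟩
    have hf : ((Units.map ((invariants G X).subtype : _ →* functions X) f : (functions X)ˣ) :
        functions X) ∈ invariants G X := f.1.2
    rw [← prodUnit_mem_cocycles_zero hX Fin.elim0, prodUnit_zero] at hf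
    exact hf

theorem exists_cohomology_zero_mulEquiv (hX : IsIntegrallyClosedIn k (functions X)) :
    ∃ e : cohomology G X 0 ≃* (invariants G X)ˣ, ∀ (z : cocycles G X 0) (f : (invariants G X)ˣ),
      (z : (functions (bar G X 0))ˣ) = pull (base G X 0)
        (Units.map ((invariants G X).subtype : _ →* functions X) f) →
      e (QuotientGroup.mk z) = f := by
  let ψ : (invariants G X)ˣ →* cocycles G X 0 :=
    ((pull (base G X 0)).comp (Units.map ((invariants G X).subtype : _ →* functions X))).codRestrict
      _ fun f => (mem_cocycles_zero_iff hX _).2 ⟨f, rfl⟩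
  let φ : (invariants G X)ˣ →* cohomology G X 0 := (QuotientGroup.mk' _).comp ψ
  have hφ : Function.Bijective φ := by
    refine ⟨(injective_iff_map_eq_one φ).2 fun f h => ?_, fun x => ?_⟩
    · have h1 : pull (base G X 0)
          (Units.map ((invariants G X).subtype : _ →* functions X) f) = 1 :=
        Subgroup.mem_bot.1 ((QuotientGroup.eq_one_iff (ψ f)).1 h)
      refine Units.map_injective (f := ((invariants G X).subtype : _ →* functions X))
        Subtype.val_injective (pull_injective_of_iso (barZeroIso G X) ?_)
      rw [map_one, map_one]
      exact h1
    · obtain ⟨⟨z, hz⟩, rfl⟩ := QuotientGroup.mk_surjective x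
      obtain ⟨f, hf⟩ := (mem_cocycles_zero_iff hX z).1 hz
      exact ⟨f, congrArg QuotientGroup.mk (Subtype.ext hf.symm)⟩
  refine ⟨(MulEquiv.ofBijective φ hφ).symm, fun z f hz => ?_⟩
  rw [MulEquiv.symm_apply_eq]
  exact congrArg QuotientGroup.mk (Subtype.ext hz)

theorem exists_cohomology_one_mulEquiv (hX : IsIntegrallyClosedIn k (functions X)) :
    ∃ e : cohomology G X 1 ≃* (characters G ⧸ semiCharacters G X),
      ∀ (z : cocycles G X 1) (χ : characters G),
        (z : (functions (bar G X 1))ˣ) = pull (coord G X 0) (χ : (functions G)ˣ) →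
        e (QuotientGroup.mk z) = QuotientGroup.mk χ := by
  have hcoord : ∀ c : Fin 1 → characters G,
      prodUnit G X c 1 = pull (coord G X 0) (c 0 : (functions G)ˣ) := by
    intro c
    simp [prodUnit]
  let ψ : characters G →* cocycles G X 1 :=
    ((pull (coord G X 0)).comp (characters G).subtype).codRestrict _ fun χ => by
      have := (prodUnit_mem_cocycles_odd hX 0 (fun _ => χ) 1).2
        ⟨rfl, fun i hi => (Nat.not_lt_zero i hi).elim⟩
      rwa [hcoord] at this
  let φ : characters G →* cohomology G X 1 := (QuotientGroup.mk' _).comp ψ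
  have hφ : Function.Surjective φ := fun x => by
    obtain ⟨⟨z, hz⟩, rfl⟩ := QuotientGroup.mk_surjective x
    obtain ⟨c, α, rfl⟩ := exists_prodUnit hX z
    obtain ⟨rfl, -⟩ := (prodUnit_mem_cocycles_odd hX 0 c α).1 hz
    exact ⟨c 0, congrArg QuotientGroup.mk (Subtype.ext (hcoord c).symm)⟩
  have hker : φ.ker = semiCharacters G X := by
    ext χ
    have h := prodUnit_mem_coboundaries_one hX (fun _ => χ) 1
    rw [hcoord, eq_self_iff_true, true_and] at h
    rw [← h, MonoidHom.mem_ker]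
    exact QuotientGroup.eq_one_iff (ψ χ)
  refine ⟨((QuotientGroup.quotientMulEquivOfEq hker).symm.trans
    (QuotientGroup.quotientKerEquivOfSurjective φ hφ)).symm, fun z χ hz => ?_⟩
  rw [MulEquiv.symm_apply_eq]
  exact congrArg QuotientGroup.mk (Subtype.ext hz)

theorem subsingleton_cohomology (hX : IsIntegrallyClosedIn k (functions X)) {n : ℕ} (hn : 2 ≤ n) :
    Subsingleton (cohomology G X n) := by
  have h : coboundaries G X n = cocycles G X n := by
    obtain ⟨m, rfl⟩ := Nat.exists_eq_add_of_le hn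
    rcases Nat.even_or_odd' m with ⟨j, rfl | rfl⟩
    · rw [_root_.add_comm]
      exact coboundaries_eq_cocycles_even hX j
    · rw [show 2 + (2 * j + 1) = 2 * j + 3 by omega]
      exact coboundaries_eq_cocycles_odd hX j
  rw [QuotientGroup.subsingleton_iff, h, Subgroup.subgroupOf_self]

end Cohomology

end AlgCoh

theorem mainTheorem8 {k : Type u} [Field k]
    (G : Over (Spec (.of k))) [GrpObj G]
    [Smooth G.hom] [LocallyOfFiniteType G.hom] [QuasiCompact G.hom] [ConnectedSpace G.left]
    (X : Over (Spec (.of k))) [ModObj G X]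
    [CompactSpace X.left] [QuasiSeparatedSpace X.left]
    (hred : _root_.IsReduced (AlgCoh.functions X))
    (hclosed : IsIntegrallyClosedIn k (AlgCoh.functions X)) :
    -- units on `Gⁿ × X` factor uniquely
    (∀ (n : ℕ) (χ : (AlgCoh.functions (AlgCoh.bar G X n))ˣ),
      ∃! p : (Fin n → AlgCoh.characters G) × (AlgCoh.functions X)ˣ,
        χ = AlgCoh.prodUnit G X p.1 p.2) ∧
    -- `Z⁰` and `B⁰`
    (∀ χ : (AlgCoh.functions (AlgCoh.bar G X 0))ˣ, χ ∈ AlgCoh.cocycles G X 0 ↔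
      ∃ f : (AlgCoh.invariants G X)ˣ,
        χ = AlgCoh.pull (AlgCoh.base G X 0)
          (Units.map ((AlgCoh.invariants G X).subtype : _ →* AlgCoh.functions X) f)) ∧
    AlgCoh.coboundaries G X 0 = ⊥ ∧
    -- `Zⁿ` and `Bⁿ` for even `n = 2m + 2`
    (∀ (m : ℕ) (c : Fin (2 * m + 2) → AlgCoh.characters G) (α : (AlgCoh.functions X)ˣ),
      AlgCoh.prodUnit G X c α ∈ AlgCoh.cocycles G X (2 * m + 2) ↔
        AlgCoh.IsSemiInvariant G X (c 0) α ∧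
        (∀ i : Fin m, c ⟨2 * i + 1, by omega⟩ = c ⟨2 * i + 2, by omega⟩) ∧
        c (Fin.last (2 * m + 1)) = 1) ∧
    (∀ m : ℕ, AlgCoh.coboundaries G X (2 * m + 2) = AlgCoh.cocycles G X (2 * m + 2)) ∧
    -- `Zⁿ` for odd `n = 2m + 1`
    (∀ (m : ℕ) (c : Fin (2 * m + 1) → AlgCoh.characters G) (α : (AlgCoh.functions X)ˣ),
      AlgCoh.prodUnit G X c α ∈ AlgCoh.cocycles G X (2 * m + 1) ↔
        α = 1 ∧ ∀ i : Fin m, c ⟨2 * i + 1, by omega⟩ = 1) ∧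
    -- `Bⁿ` for odd `n = 2m + 3`, and `B¹`
    (∀ m : ℕ, AlgCoh.coboundaries G X (2 * m + 3) = AlgCoh.cocycles G X (2 * m + 3)) ∧
    (∀ (c : Fin 1 → AlgCoh.characters G) (α : (AlgCoh.functions X)ˣ),
      AlgCoh.prodUnit G X c α ∈ AlgCoh.coboundaries G X 1 ↔
        α = 1 ∧ c 0 ∈ AlgCoh.semiCharacters G X) ∧
    -- the cohomology groups
    (∃ e : AlgCoh.cohomology G X 0 ≃* (AlgCoh.invariants G X)ˣ,
      ∀ (z : AlgCoh.cocycles G X 0) (f : (AlgCoh.invariants G X)ˣ),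
        (z : (AlgCoh.functions (AlgCoh.bar G X 0))ˣ) = AlgCoh.pull (AlgCoh.base G X 0)
          (Units.map ((AlgCoh.invariants G X).subtype : _ →* AlgCoh.functions X) f) →
        e (QuotientGroup.mk z) = f) ∧
    (∃ e : AlgCoh.cohomology G X 1 ≃*
        (AlgCoh.characters G ⧸ AlgCoh.semiCharacters G X),
      ∀ (z : AlgCoh.cocycles G X 1) (χ : AlgCoh.characters G),
        (z : (AlgCoh.functions (AlgCoh.bar G X 1))ˣ) =
          AlgCoh.pull (AlgCoh.coord G X 0) (χ : (AlgCoh.functions G)ˣ) →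
        e (QuotientGroup.mk z) = QuotientGroup.mk χ) ∧
    (∀ n : ℕ, 2 ≤ n → Subsingleton (AlgCoh.cohomology G X n)) := by
  refine ⟨fun n u => ?_, AlgCoh.mem_cocycles_zero_iff hclosed, rfl,
    fun m c α => (AlgCoh.prodUnit_mem_cocycles_even hclosed m c α).trans (by rw [Fin.forall_iff]),
    AlgCoh.coboundaries_eq_cocycles_even hclosed,
    fun m c α => (AlgCoh.prodUnit_mem_cocycles_odd hclosed m c α).trans (by rw [Fin.forall_iff]),
    AlgCoh.coboundaries_eq_cocycles_odd hclosed,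
    AlgCoh.prodUnit_mem_coboundaries_one hclosed, AlgCoh.exists_cohomology_zero_mulEquiv hclosed,
    AlgCoh.exists_cohomology_one_mulEquiv hclosed,
    fun n hn => AlgCoh.subsingleton_cohomology hclosed hn⟩
  obtain ⟨p, hp, huniq⟩ := (AlgCoh.prodUnitHom_bijective G X hclosed n).existsUnique u
  exact ⟨p, hp.symm, fun q hq => huniq q hq.symm⟩
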